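/- Let $G$ be a finitely generated group, $u:G\to\mathbb{R}$ a nonzero homomorphism and $H$ a normal subgroup of finite index in $G$. Let $R=\mathbb{Z}[G/\ker u]$, a Noetherian unique factorization domain whose units are $\pm(G/\ker u)$. Let $G$ act on $R^{G/H}$ through left multiplication on $R$ and left translation on the index set $G/H$. This action commutes with the factorwise multiplication by $R$, so the homology group $H_1(G;R^{G/H})$ is an $R$-module. For a finitely generated $R$-module $M$ with a finite presentation $R^q\xrightarrow{\times A}R^p\to M\to 0$, $A\in \mathrm{M}_{q,p}(R)$, let $\mathrm{ord}_R(M)\in R$ be the greatest common divisor of the $p$-minors of $A$, which is defined up to units. The twisted Alexander polynomial is $$\Delta^H(G,u):=\mathrm{ord}_R\big(H_1(G;R^{G/H})\big)\in R\ \text{ modulo units}.$$ It is called $u$-monic if its $u$-minimal part is $\pm g$ for some $g\in G/\ker u$, i.e. if the coefficient of $g$ is $\pm1$ and $\overline u(h)>\overline u(g)$ for every other $h$ in the support, where $\overline u$ is the homomorphism $G/\ker u\to\mathbb{R}$ induced by $u$. Write $\overline u$ also for the homomorphism $G/(H\cap\ker u)\to\mathbb{R}$ induced by $u$, and let $\mathbb{Z}[G/(H\cap\ker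 u)]_{\overline u}$ be the Novikov ring of formal integral series $\lambda$ over $G/(H\cap\ker u)$ such that $\mathrm{supp}(\lambda)\cap\{\overline u\le C\}$ is finite for every $C\in\mathbb{R}$; it is a left $\mathbb{Z}[G]$-module by left multiplication. The Abelianized relative Novikov homology is $$H_1^{ab}(G,H,u):=H_1\big(G;\mathbb{Z}[G/(H\cap\ker u)]_{\overline u}\big).$$ Then the twisted Alexander polynomial $\Delta^H(G,u)$ exists (that is, $H_1(G;R^{G/H})$ has a finite presentation over $R$ whose $p$-minors have a greatest common divisor), and $$\Delta^H(G,u)\ \text{is $u$-monic}\iff H_1^{ab}(G,H,u)=0.$$ -/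

import Mathlib

noncomputable section

namespace TwistedAlexander

/-! Homomorphisms to the additive group of real numbers are written `u : G →* Multiplicative ℝ`,
so that `u.ker` is a subgroup of `G`; the real number `u(g)` is `(u g).toAdd`. -/

/-! ### Order of a finitely generated module -/

/-- The ideal generated by the `p`-minors of a `q × p` matrix (the determinants of the square
matrices formed by `p` of its rows). It is `0` if `q < p`, and the unit ideal if `p = 0`. -/
def minorIdeal {R : Type*} [CommRing R] {p q : ℕ} (A : Matrix (Fin q) (Fin p) R) : Ideal R :=
  Ideal.span (Set.range fun e : Fin p ↪o Fin q => (A.submatrix e id).det)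

/-- `R^q --(× A)--> R^p --π--> M → 0` is a presentation of `M`; elements of `R^q` and `R^p` are row
vectors, and `× A` is right multiplication by `A`. -/
def IsMatrixPresentation {R : Type*} [CommRing R] {M : Type*} [AddCommGroup M] [Module R M]
    {p q : ℕ} (A : Matrix (Fin q) (Fin p) R) (π : (Fin p → R) →ₗ[R] M) : Prop :=
  Function.Surjective π ∧ LinearMap.ker π = LinearMap.range A.vecMulLinear

/-- `d` is a greatest common divisor of the elements of the ideal `I`. -/
def IsGcdOfIdeal {R : Type*} [CommRing R] (I : Ideal R) (d : R) : Prop :=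
  ∀ a : R, a ∣ d ↔ ∀ x ∈ I, a ∣ x

/-- `d` is (a representative, up to units, of) the order `ord_R(M)`: a greatest common divisor of
the Fitting ideal of order `0`, computed from a finite presentation of `M`. -/
def IsOrder (R : Type*) [CommRing R] (M : Type*) [AddCommGroup M] [Module R M] (d : R) : Prop :=
  ∃ (p q : ℕ) (A : Matrix (Fin q) (Fin p) R) (π : (Fin p → R) →ₗ[R] M),
    IsMatrixPresentation A π ∧ IsGcdOfIdeal (minorIdeal A) d

variable {G : Type} [Group G]

/-! ### Twisted Alexander polynomials -/

/-- `G / ker u` is commutative, being isomorphic to a group of real numbers. -/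
instance quotientKerCommGroup (u : G →* Multiplicative ℝ) : CommGroup (G ⧸ u.ker) :=
  { (inferInstance : Group (G ⧸ u.ker)) with
    mul_comm := fun a b => QuotientGroup.kerLift_injective u (by
      rw [map_mul, map_mul, mul_comm]) }

/-- The commutative ring `ℤ[G / ker u]`. -/
abbrev QuotientRing (u : G →* Multiplicative ℝ) : Type := MonoidAlgebra ℤ (G ⧸ u.ker)

/-- The `G`-module `ℤ[G / ker u]^(G/H)`, with `G` acting both on `ℤ[G / ker u]` (by left
multiplication) and on the index set `G/H`. The action is `ℤ[G / ker u]`-linear for the module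
structure in which `ℤ[G / ker u]` multiplies every factor and does not permute the factors. -/
def alexanderRep (H : Subgroup G) (u : G →* Multiplicative ℝ) :
    Representation (QuotientRing u) G (G ⧸ H → QuotientRing u) where
  toFun g :=
    { toFun := fun f x => MonoidAlgebra.single (g : G ⧸ u.ker) (1 : ℤ) * f (g⁻¹ • x)
      map_add' := fun f f' => by
        funext x
        simp [mul_add]
      map_smul' := fun r f => by
        funext x
        simp [mul_left_comm] }
  map_one' := by
    refine LinearMap.ext fun f => funext fun x => ?_
    simp [← MonoidAlgebra.one_def]
  map_mul' g h := by
    refine LinearMap.ext fun f => funext fun x => ?_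
    simp [← mul_assoc, MonoidAlgebra.single_mul_single, mul_smul]

/-- `H₁(G; ℤ[G / ker u]^(G/H))`, as a module over `ℤ[G / ker u]`. -/
abbrev alexanderModule (H : Subgroup G) (u : G →* Multiplicative ℝ) :
    ModuleCat (QuotientRing u) :=
  groupHomology (Rep.of (alexanderRep H u)) 1

/-- `Δ` represents the twisted Alexander polynomial `Δ^H(G,u)`, which is an element of
`ℤ[G / ker u]` defined up to units. -/
def IsTwistedAlexanderPolynomial (H : Subgroup G) (u : G →* Multiplicative ℝ)
    (Δ : QuotientRing u) : Prop :=
  IsOrder (QuotientRing u) (alexanderModule H u) Δ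

/-- An element of `ℤ[Q]` is `v`-monic if its `v`-minimal part is `± g` for some `g` in `Q`. -/
def IsMonic {Q : Type*} [Group Q] (v : Q →* Multiplicative ℝ) (a : MonoidAlgebra ℤ Q) : Prop :=
  ∃ g : Q, (a.coeff g = 1 ∨ a.coeff g = -1) ∧ ∀ h : Q, h ≠ g → a.coeff h ≠ 0 →
    (v g).toAdd < (v h).toAdd

/-! ### Novikov homology -/

/-- The additive group of the Novikov ring `ℤ[Q]_v`: the formal series `∑ a_g g` with integer
coefficients such that, for every real `C`, only finitely many elements `g` of the support
satisfy `v(g) ≤ C`. -/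
def novikov {Q : Type*} [Group Q] (v : Q →* Multiplicative ℝ) : Submodule ℤ (Q → ℤ) where
  carrier := {a | ∀ C : ℝ, {g : Q | a g ≠ 0 ∧ (v g).toAdd ≤ C}.Finite}
  zero_mem' C := by simp
  add_mem' := by
    intro a b ha hb C
    refine ((ha C).union (hb C)).subset ?_
    rintro g ⟨hg, hC⟩
    by_cases h : a g = 0
    · exact Or.inr ⟨fun h' => hg (by simp [h, h']), hC⟩
    · exact Or.inl ⟨h, hC⟩
  smul_mem' := by
    intro n a ha C
    refine (ha C).subset ?_
    rintro g ⟨hg, hC⟩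
    exact ⟨fun h => hg (by simp [h]), hC⟩

/-- Left multiplication by elements of `Q` on the Novikov ring `ℤ[Q]_v`:
the coefficient of `x` in `g * a` is the coefficient of `g⁻¹ * x` in `a`. -/
def novikovRep {Q : Type*} [Group Q] (v : Q →* Multiplicative ℝ) :
    Representation ℤ Q (novikov v) where
  toFun g :=
    { toFun := fun a => ⟨fun x => a.1 (g⁻¹ * x), fun C => by
        refine ((a.2 (C - (v g).toAdd)).image (fun x => g * x)).subset ?_
        rintro x ⟨hx, hC⟩
        refine ⟨g⁻¹ * x, ⟨hx, ?_⟩, by simp⟩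
        simp only [map_mul, map_inv, toAdd_mul, toAdd_inv]
        linarith⟩
      map_add' := fun a b => rfl
      map_smul' := fun n a => rfl }
  map_one' := by
    refine LinearMap.ext fun a => Subtype.ext (funext fun x => ?_)
    simp
  map_mul' g h := by
    refine LinearMap.ext fun a => Subtype.ext (funext fun x => ?_)
    simp [mul_assoc]

/-- The homomorphism `ū : G / (H ∩ ker u) → ℝ` induced by `u`. -/
def inducedHom (H : Subgroup G) [H.Normal] (u : G →* Multiplicative ℝ) :
    G ⧸ (H ⊓ u.ker) →* Multiplicative ℝ :=
  QuotientGroup.lift (H ⊓ u.ker) u fun _ hx => hx.2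

/-- The Abelianized relative Novikov homology `H₁^{ab}(G,H,u) = H₁(G; ℤ[G / (H ∩ ker u)]_ū)`, the
coefficients being a left `G`-module through the projection `G → G / (H ∩ ker u)`. -/
abbrev abelianizedNovikovHomology (H : Subgroup G) [H.Normal] (u : G →* Multiplicative ℝ) :
    ModuleCat ℤ :=
  groupHomology (Rep.of ((novikovRep (inducedHom H u)).comp (QuotientGroup.mk' (H ⊓ u.ker)))) 1

end TwistedAlexander

end

noncomputable section

namespace TwistedAlexander

/-! ### First homology in terms of inhomogeneous chains -/

section Chains

variable {k G V V' : Type} [CommRing k] [Group G] [AddCommGroup V] [Module k V]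

/-! Let A = G / ker u, embedded in ℝ by v, let R = ℤ[A] and M = H₁(G; R^(G/H)). Both sides of the
equivalence say that some monic element of R kills M.

Polynomial side. The ideal of p-minors kills M, and it contains s ^ p whenever s kills M; so a monic
element kills M exactly when this ideal contains one. By `IsGcdOfIdeal.isMonic_iff` this can be read
off the gcd: an ideal without monic elements lies in a prime P without monic elements, P is
principal, its generator divides the gcd, so the gcd lies in P. The principality of P is
`isPrincipal_of_forall_not_isMonic`. If P contains a prime number, that number generates P.
Otherwise the fraction field of R/P carries a valuation w with w(a) < 1 whenever v(a) > 0, hence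
w(a) ≠ 1 for a ≠ 1, while the values of nonzero integers are powers of a single ϖ. Elements a with
w(a) a power of ϖ are then pairwise commensurable, so (for A nontrivial) some coordinate hyperplane
of A meets them only in 1. A nonzero element of R supported there has terms of distinct values and
is not in P. Thus P contracts to zero in the ring of the remaining variables, and Gauss's lemma
makes it principal.

Homology side. Let N be the Novikov completion of R. The group G / (H ∩ ker u) acts freely on A ×
G/H, so N^(G/H) is made of copies of the relative Novikov ring, one for each orbit (`extendOrbit`,
`restrictOrbit`). Flatness of N is never needed: `cycleMap` sends all chains to cycles and
multiplies cycles by the monic element γ ^ [G : H] - 1, where u(γ) > 0. If s kills M, it follows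
that s times this element kills the homology of N^(G/H); both act bijectively on N, so that homology
vanishes. Conversely, if the cycles produced by `cycleMap` bound over N, truncating the bounding
chains makes them homologous over R to combinations of finitely many generators with coefficients of
positive order. A determinant argument as in Nakayama's lemma then yields a monic annihilator
(`exists_isMonic_smul_mem_range`). -/

/-- The differential from `1`-chains to `0`-chains. -/
def diffOne (ρ : Representation k G V) : (G →₀ V) →ₗ[k] V :=
  Finsupp.lsum k fun g => ρ g⁻¹ - LinearMap.id

/-- The differential from `2`-chains to `1`-chains. -/
def diffTwo (ρ : Representation k G V) : (G × G →₀ V) →ₗ[k] (G →₀ V) :=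
  Finsupp.lsum k fun g =>
    Finsupp.lsingle g.2 ∘ₗ ρ g.1⁻¹ - Finsupp.lsingle (g.1 * g.2) + Finsupp.lsingle g.1

@[simp]
lemma diffOne_single (ρ : Representation k G V) (g : G) (v : V) :
    diffOne ρ (Finsupp.single g v) = ρ g⁻¹ v - v := by
  simp [diffOne]

@[simp]
lemma diffTwo_single (ρ : Representation k G V) (g : G × G) (v : V) :
    diffTwo ρ (Finsupp.single g v) =
      Finsupp.single g.2 (ρ g.1⁻¹ v) - Finsupp.single (g.1 * g.2) v + Finsupp.single g.1 v := by
  simp [diffTwo]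

lemma diffOne_diffTwo (ρ : Representation k G V) (w : G × G →₀ V) :
    diffOne ρ (diffTwo ρ w) = 0 := by
  induction w using Finsupp.induction_linear with
  | zero => simp
  | add a b ha hb => simp [ha, hb]
  | single g v => simp

/-- First group homology is the quotient of the cycles by the boundaries. -/
def homologyOneEquiv (ρ : Representation k G V) :
    ((LinearMap.ker (diffOne ρ)) ⧸ (LinearMap.range (diffTwo ρ)).comap
      (LinearMap.ker (diffOne ρ)).subtype) ≃ₗ[k] groupHomology (Rep.of ρ) 1 :=
  (Submodule.quotEquivOfEq _ _ (by
    ext x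
    exact (groupHomology.H1π_eq_zero_iff (A := Rep.of ρ) x).symm)).trans
  ((groupHomology.H1π (Rep.of ρ)).hom.quotKerEquivOfSurjective
    ((ModuleCat.epi_iff_surjective _).1 inferInstance))

lemma subsingleton_homologyOne_iff (ρ : Representation k G V) :
    Subsingleton (groupHomology (Rep.of ρ) 1) ↔
      LinearMap.ker (diffOne ρ) ≤ LinearMap.range (diffTwo ρ) := by
  rw [← (homologyOneEquiv ρ).toEquiv.subsingleton_congr, Submodule.Quotient.subsingleton_iff,
    Submodule.comap_subtype_eq_top]

/-- A scalar annihilates the first homology if and only if it maps cycles to boundaries. -/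
lemma smul_homologyOne_eq_zero_iff (ρ : Representation k G V) (s : k) :
    (∀ m : groupHomology (Rep.of ρ) 1, s • m = 0) ↔
      ∀ z, diffOne ρ z = 0 → s • z ∈ LinearMap.range (diffTwo ρ) := by
  constructor
  · intro h z hz
    have := h (homologyOneEquiv ρ (Submodule.Quotient.mk ⟨z, hz⟩))
    rw [← map_smul, LinearEquiv.map_eq_zero_iff, ← Submodule.Quotient.mk_smul,
      Submodule.Quotient.mk_eq_zero] at this
    exact this
  · intro h m
    obtain ⟨q, rfl⟩ := (homologyOneEquiv ρ).surjective m
    obtain ⟨⟨z, hz⟩, rfl⟩ := Submodule.Quotient.mk_surjective _ q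
    rw [← map_smul, LinearEquiv.map_eq_zero_iff, ← Submodule.Quotient.mk_smul,
      Submodule.Quotient.mk_eq_zero]
    exact h z hz

section Naturality

variable {k' : Type} [CommRing k'] [AddCommGroup V'] [Module k' V']

/-- The coefficient map is only additive and the two scalar rings may differ, because the relative
Novikov module is taken over ℤ and the completed module over ℤ[G / ker u]. -/
lemma diffOne_mapRange (ρ : Representation k G V) (ρ' : Representation k' G V') (f : V →+ V')
    (hf : ∀ g v, f (ρ g v) = ρ' g (f v)) (z : G →₀ V) :
    diffOne ρ' (Finsupp.mapRange.addMonoidHom f z) = f (diffOne ρ z) := by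
  induction z using Finsupp.induction_linear with
  | zero => simp
  | add a b ha hb => simp only [map_add, ha, hb]
  | single g v => simp [hf]

lemma diffTwo_mapRange (ρ : Representation k G V) (ρ' : Representation k' G V') (f : V →+ V')
    (hf : ∀ g v, f (ρ g v) = ρ' g (f v)) (w : G × G →₀ V) :
    diffTwo ρ' (Finsupp.mapRange.addMonoidHom f w) =
      Finsupp.mapRange.addMonoidHom f (diffTwo ρ w) := by
  induction w using Finsupp.induction_linear with
  | zero => simp
  | add a b ha hb => simp only [map_add, ha, hb]
  | single g v =>
    simp only [diffTwo_single, map_add, map_sub, Finsupp.mapRange.addMonoidHom_apply,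
      Finsupp.mapRange_single, hf]

end Naturality

/-- Modulo boundaries, the `1`-chains of a finitely generated group with finitely generated
coefficients are finitely generated. -/
lemma fg_top_chains_quotient_boundaries [Group.FG G] (ρ : Representation k G V)
    [Module.Finite k V] :
    (⊤ : Submodule k ((G →₀ V) ⧸ LinearMap.range (diffTwo ρ))).FG := by
  obtain ⟨X, hX⟩ := (Group.fg_def).1 (inferInstance : Group.FG G)
  let q := (LinearMap.range (diffTwo ρ)).mkQ
  let N : Submodule k ((G →₀ V) ⧸ LinearMap.range (diffTwo ρ)) :=
    ⨆ x : X, Submodule.map (q ∘ₗ Finsupp.lsingle (x : G)) ⊤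
  -- The boundary of the 2-chain on (g, h) expresses the class at a product through classes at the
  -- factors, so a generating set of G suffices.
  have hrel (g h : G) (v : V) : q (Finsupp.single (g * h) v) =
      q (Finsupp.single h (ρ g⁻¹ v)) + q (Finsupp.single g v) := by
    rw [← sub_eq_zero, ← map_add, ← map_sub]
    refine (Submodule.Quotient.mk_eq_zero _).2 ⟨-Finsupp.single (g, h) v, ?_⟩
    rw [map_neg, diffTwo_single]
    abel
  have hone (v : V) : q (Finsupp.single 1 v) = 0 := by
    have := hrel 1 1 v
    simpa using this
  have hN (g : G) : ∀ v, q (Finsupp.single g v) ∈ N := by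
    have hg : g ∈ Subgroup.closure (X : Set G) := by rw [hX]; trivial
    induction hg using Subgroup.closure_induction with
    | mem x hx =>
      intro v
      exact Submodule.mem_iSup_of_mem (⟨x, hx⟩ : X) ⟨v, trivial, rfl⟩
    | one => intro v; rw [hone]; exact zero_mem _
    | mul x y _ _ hx hy => intro v; rw [hrel]; exact add_mem (hy _) (hx _)
    | inv x _ hx =>
      intro v
      have := hrel x x⁻¹ (ρ x v)
      rw [mul_inv_cancel, hone] at this
      simp only [Representation.inv_self_apply] at this
      rw [eq_neg_of_add_eq_zero_left this.symm]
      exact neg_mem (hx _)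
  have htop : N = ⊤ := by
    rw [eq_top_iff]
    rintro y -
    obtain ⟨z, rfl⟩ := Submodule.mkQ_surjective _ y
    change q z ∈ N
    induction z using Finsupp.induction_linear with
    | zero => simp
    | add a b ha hb => rw [map_add]; exact add_mem ha hb
    | single g v => exact hN g v
  rw [← htop]
  exact Submodule.fg_iSup _ fun x => Submodule.FG.map _ Module.Finite.fg_top

end Chains

/-! ### Initial terms in the group ring of a group of real numbers -/

section InitialTerms

variable {A : Type} [CommGroup A] {v : A →* Multiplicative ℝ}

lemma noZeroDivisors_of_injective (hv : Function.Injective v) :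
    NoZeroDivisors (MonoidAlgebra ℤ A) :=
  have : UniqueProds A := UniqueProds.of_injective_mulHom v.toMulHom hv inferInstance
  inferInstance

lemma isDomain_of_injective (hv : Function.Injective v) : IsDomain (MonoidAlgebra ℤ A) :=
  have := noZeroDivisors_of_injective hv
  NoZeroDivisors.to_isDomain _

variable (v) in
/-- `g` is the `v`-minimal element of the support of `a`. -/
def IsInitial (a : MonoidAlgebra ℤ A) (g : A) : Prop :=
  a.coeff g ≠ 0 ∧ ∀ h, h ≠ g → a.coeff h ≠ 0 → (v g).toAdd < (v h).toAdd

lemma IsInitial.le {a : MonoidAlgebra ℤ A} {g h : A} (hg : IsInitial v a g)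
    (hh : a.coeff h ≠ 0) : (v g).toAdd ≤ (v h).toAdd := by
  by_cases e : h = g
  · rw [e]
  · exact (hg.2 h e hh).le

lemma IsInitial.eq {a : MonoidAlgebra ℤ A} {g h : A} (hg : IsInitial v a g)
    (hh : IsInitial v a h) : g = h := by
  by_contra e
  exact lt_asymm (hg.2 h (Ne.symm e) hh.1) (hh.2 g e hg.1)

lemma exists_isInitial (hv : Function.Injective v) {a : MonoidAlgebra ℤ A} (ha : a ≠ 0) :
    ∃ g, IsInitial v a g := by
  obtain ⟨g, hg, hmin⟩ := Finset.exists_min_image a.coeff.support (fun g => (v g).toAdd)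
    (Finsupp.support_nonempty_iff.2 (by simpa using ha))
  refine ⟨g, by simpa using hg, fun h hne hh => ?_⟩
  refine lt_of_le_of_ne (hmin h (by simpa using hh)) fun e => hne ?_
  exact (hv (Multiplicative.toAdd.injective e)).symm

lemma exists_mul_of_coeff_mul_ne_zero {a b : MonoidAlgebra ℤ A} {x : A}
    (hx : (a * b).coeff x ≠ 0) : ∃ g h, a.coeff g ≠ 0 ∧ b.coeff h ≠ 0 ∧ g * h = x := by
  classical
  have := MonoidAlgebra.support_coeff_mul_subset a b (Finsupp.mem_support_iff.2 hx)
  obtain ⟨g, hg, h, hh, e⟩ := Finset.mem_mul.1 this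
  exact ⟨g, h, by simpa using hg, by simpa using hh, e⟩

/-- Any other pair of terms with product g * h would have a larger sum of v-values, or equal values
and hence equal group elements by injectivity. Neither g nor h has to lie in the support, which is
what makes `constCoeff` multiplicative. -/
lemma coeff_mul_of_le (hv : Function.Injective v) {a b : MonoidAlgebra ℤ A} {g h : A}
    (ha : ∀ x, a.coeff x ≠ 0 → (v g).toAdd ≤ (v x).toAdd)
    (hb : ∀ x, b.coeff x ≠ 0 → (v h).toAdd ≤ (v x).toAdd) :
    (a * b).coeff (g * h) = a.coeff g * b.coeff h := by
  refine MonoidAlgebra.coeff_mul_mul_of_uniqueMul fun x y hx hy e => ?_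
  have hx' := ha x (by simpa using hx)
  have hy' := hb y (by simpa using hy)
  have e' := congrArg (fun z => (v z).toAdd) e
  simp only [map_mul, toAdd_mul] at e'
  constructor <;> refine hv (Multiplicative.toAdd.injective ?_) <;> linarith

lemma IsInitial.coeff_mul (hv : Function.Injective v) {a b : MonoidAlgebra ℤ A} {g h : A}
    (ha : IsInitial v a g) (hb : IsInitial v b h) :
    (a * b).coeff (g * h) = a.coeff g * b.coeff h :=
  coeff_mul_of_le hv (fun _ => ha.le) (fun _ => hb.le)

lemma IsInitial.mul (hv : Function.Injective v) {a b : MonoidAlgebra ℤ A} {g h : A}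
    (ha : IsInitial v a g) (hb : IsInitial v b h) : IsInitial v (a * b) (g * h) := by
  refine ⟨by rw [ha.coeff_mul hv hb]; exact mul_ne_zero ha.1 hb.1, fun x hne hx => ?_⟩
  obtain ⟨y, z, hy, hz, rfl⟩ := exists_mul_of_coeff_mul_ne_zero hx
  refine lt_of_le_of_ne ?_ fun e => hne (hv (Multiplicative.toAdd.injective e)).symm
  simp only [map_mul, toAdd_mul]
  exact add_le_add (ha.le hy) (hb.le hz)

lemma isMonic_iff {a : MonoidAlgebra ℤ A} :
    IsMonic v a ↔ ∃ g, IsInitial v a g ∧ IsUnit (a.coeff g) := by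
  constructor
  · rintro ⟨g, h1, h2⟩
    have h := Int.isUnit_iff.2 h1
    exact ⟨g, ⟨h.ne_zero, h2⟩, h⟩
  · rintro ⟨g, h1, h2⟩
    exact ⟨g, Int.isUnit_iff.1 h2, h1.2⟩

/-- Initial terms multiply, and a product of integers is a unit only if both factors are. The monic
elements are therefore closed under divisors, which passes monicity from an ideal to its gcd. -/
lemma isMonic_mul_iff (hv : Function.Injective v) {a b : MonoidAlgebra ℤ A} :
    IsMonic v (a * b) ↔ IsMonic v a ∧ IsMonic v b := by
  constructor
  · intro h
    obtain ⟨x, hx, hu⟩ := isMonic_iff.1 h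
    have hab : a * b ≠ 0 := fun e => hx.1 (by simp [e])
    obtain ⟨g, hg⟩ := exists_isInitial hv (left_ne_zero_of_mul hab)
    obtain ⟨k, hk⟩ := exists_isInitial hv (right_ne_zero_of_mul hab)
    obtain rfl := (hg.mul hv hk).eq hx
    rw [hg.coeff_mul hv hk, IsUnit.mul_iff] at hu
    exact ⟨isMonic_iff.2 ⟨g, hg, hu.1⟩, isMonic_iff.2 ⟨k, hk, hu.2⟩⟩
  · rintro ⟨ha, hb⟩
    obtain ⟨g, hg, hgu⟩ := isMonic_iff.1 ha
    obtain ⟨k, hk, hku⟩ := isMonic_iff.1 hb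
    exact isMonic_iff.2 ⟨g * k, hg.mul hv hk, by rw [hg.coeff_mul hv hk]; exact hgu.mul hku⟩

lemma isMonic_one : IsMonic v (1 : MonoidAlgebra ℤ A) := by
  classical
  refine ⟨1, Or.inl (by simp), fun h hne hh => absurd ?_ hh⟩
  rw [MonoidAlgebra.one_def, MonoidAlgebra.coeff_single, Finsupp.single_apply, if_neg hne.symm]

/-- The multiplicative set of monic elements. -/
def monicSubmonoid (hv : Function.Injective v) : Submonoid (MonoidAlgebra ℤ A) where
  carrier := {a | IsMonic v a}
  one_mem' := isMonic_one
  mul_mem' ha hb := (isMonic_mul_iff hv).2 ⟨ha, hb⟩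

variable (v) in
/-- The subring of elements all of whose terms have nonnegative `v`. -/
def nonnegSubring : Subring (MonoidAlgebra ℤ A) where
  carrier := {a | ∀ g, a.coeff g ≠ 0 → 0 ≤ (v g).toAdd}
  zero_mem' g := by simp
  one_mem' g hg := by
    classical
    rw [MonoidAlgebra.one_def, MonoidAlgebra.coeff_single, Finsupp.single_apply] at hg
    split_ifs at hg with e
    · simp [← e]
    · exact absurd rfl hg
  add_mem' {a b} ha hb g hg := by
    by_cases h : a.coeff g = 0
    · exact hb g fun h' => hg (by simp [h, h'])
    · exact ha g h
  neg_mem' {a} ha g hg := ha g (by simpa using hg)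
  mul_mem' {a b} ha hb g hg := by
    obtain ⟨y, z, hy, hz, rfl⟩ := exists_mul_of_coeff_mul_ne_zero hg
    simp only [map_mul, toAdd_mul]
    exact add_nonneg (ha y hy) (hb z hz)

/-- The coefficient of `1`, as a ring homomorphism on elements with nonnegative terms. -/
def constCoeff (hv : Function.Injective v) : nonnegSubring v →+* ℤ where
  toFun a := a.1.coeff 1
  map_one' := by simp
  map_zero' := by simp
  map_add' a b := by simp
  map_mul' a b := by
    have := coeff_mul_of_le hv (a := a.1) (b := b.1) (g := 1) (h := 1)
      (fun x hx => by simpa using a.2 x hx) (fun x hx => by simpa using b.2 x hx)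
    simpa using this

lemma constCoeff_apply (hv : Function.Injective v) (a : nonnegSubring v) :
    constCoeff hv a = a.1.coeff 1 := rfl

/-- This reduces monicity to a computation in ℤ through a ring homomorphism, so that it can be
checked entrywise for determinants. -/
lemma isMonic_of_isUnit_constCoeff (hv : Function.Injective v) (a : nonnegSubring v)
    (ha : IsUnit (constCoeff hv a)) : IsMonic v a.1 := by
  refine isMonic_iff.2 ⟨1, ⟨ha.ne_zero, fun h hne hh => ?_⟩, ha⟩
  refine lt_of_le_of_ne (by simpa using a.2 h hh) fun e => hne ?_
  exact (hv (Multiplicative.toAdd.injective e)).symm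

end InitialTerms

/-! ### Fitting ideals -/

section Fitting

variable {R : Type*} [CommRing R] {p q : ℕ}

/-- The generators use increasing choices of rows only: sorting an injective choice costs a sign,
and a repeated row gives determinant zero. -/
lemma det_submatrix_mem_minorIdeal (A : Matrix (Fin q) (Fin p) R) (f : Fin p → Fin q) :
    (A.submatrix f id).det ∈ minorIdeal A := by
  by_cases hf : Function.Injective f
  · let s : Finset (Fin q) := Finset.univ.map ⟨f, hf⟩
    have hs : s.card = p := by simp [s]
    let e : Fin p ↪o Fin q := s.orderEmbOfFin hs
    have hmem (i : Fin p) : ∃ j, e j = f i := by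
      have : f i ∈ Set.range e := by
        rw [Finset.range_orderEmbOfFin]
        simp [s]
      exact this
    choose σ hσ using hmem
    have hσi : Function.Injective σ := fun i j h => hf (by rw [← hσ, ← hσ, h])
    let τ : Equiv.Perm (Fin p) := Equiv.ofBijective σ (Finite.injective_iff_bijective.1 hσi)
    have : A.submatrix f id = (A.submatrix e id).submatrix τ id := by
      ext i j
      simp [τ, hσ]
    rw [this, Matrix.det_permute]
    exact Ideal.mul_mem_left _ _ (Ideal.subset_span ⟨e, rfl⟩)
  · obtain ⟨i, j, h, hne⟩ := Function.not_injective_iff.1 hf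
    rw [Matrix.det_zero_of_row_eq hne (by ext k; simp [h])]
    exact zero_mem _

/-- A consequence of the Cauchy–Binet formula. -/
lemma det_mul_mem_minorIdeal (B : Matrix (Fin p) (Fin q) R) (A : Matrix (Fin q) (Fin p) R) :
    (B * A).det ∈ minorIdeal A := by
  have h : B * A = fun i => ∑ j, B i j • A j := by
    ext i k
    simp [Matrix.mul_apply]
  have := (Matrix.detRowAlternating (n := Fin p) (R := R)).toMultilinearMap.map_sum
    (fun i j => B i j • A j)
  change (Matrix.detRowAlternating (n := Fin p) (R := R)).toMultilinearMap (B * A) ∈ _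
  rw [h, this]
  refine Ideal.sum_mem _ fun f _ => ?_
  rw [MultilinearMap.map_smul_univ]
  exact Ideal.mul_mem_left _ _ (det_submatrix_mem_minorIdeal A f)

variable {M : Type*} [AddCommGroup M] [Module R M] {A : Matrix (Fin q) (Fin p) R}
  {π : (Fin p → R) →ₗ[R] M}

/-- Cramer's rule: for a square block E of rows of A, det E • x = (x * adj E) * E is a combination
of those rows, hence a relation. -/
lemma IsMatrixPresentation.smul_eq_zero (h : IsMatrixPresentation A π) {d : R}
    (hd : d ∈ minorIdeal A) (m : M) : d • m = 0 := by
  suffices minorIdeal A ≤ Module.annihilator R M from Module.mem_annihilator.1 (this hd) m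
  refine Ideal.span_le.2 ?_
  rintro _ ⟨e, rfl⟩
  refine Module.mem_annihilator.2 fun m => ?_
  obtain ⟨x, rfl⟩ := h.1 m
  rw [← map_smul, ← LinearMap.mem_ker, h.2]
  let E := A.submatrix e id
  refine ⟨fun j => ∑ i, if e i = j then (Matrix.vecMul x E.adjugate) i else 0, ?_⟩
  have : E.det • x = Matrix.vecMul (Matrix.vecMul x E.adjugate) E := by
    rw [Matrix.vecMul_vecMul, Matrix.adjugate_mul, Matrix.vecMul_smul, Matrix.vecMul_one]
  rw [this]
  ext k
  simp [Matrix.vecMul, dotProduct, Finset.sum_mul, E, ite_mul]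
  rw [Finset.sum_comm]
  simp

/-- If s kills M, each s • eᵢ is a combination of rows of A. So s • 1 = B * A, and Cauchy–Binet puts
its determinant s ^ p in the ideal. -/
lemma IsMatrixPresentation.pow_mem_minorIdeal (h : IsMatrixPresentation A π) {s : R}
    (hs : ∀ m : M, s • m = 0) : s ^ p ∈ minorIdeal A := by
  have hrow (i : Fin p) : ∃ b, Matrix.vecMul b A = s • Pi.single i (1 : R) := by
    have : s • Pi.single i (1 : R) ∈ LinearMap.ker π := by
      rw [LinearMap.mem_ker, map_smul, hs]
    rw [h.2] at this
    exact this
  choose B hB using hrow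
  have : (Matrix.of B) * A = s • (1 : Matrix (Fin p) (Fin p) R) := by
    ext i j
    have := congrFun (hB i) j
    simp only [Pi.smul_apply, Pi.single_apply, Matrix.smul_apply, Matrix.one_apply] at this ⊢
    simp only [eq_comm (a := i), ← this]
    rfl
  have h2 := det_mul_mem_minorIdeal (Matrix.of B) A
  rw [this, Matrix.det_smul, Matrix.det_one] at h2
  simpa using h2

/-- A finitely generated module over a Noetherian ring has a matrix presentation. -/
lemma exists_isMatrixPresentation [IsNoetherianRing R] [Module.Finite R M] :
    ∃ (p q : ℕ) (A : Matrix (Fin q) (Fin p) R) (π : (Fin p → R) →ₗ[R] M),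
      IsMatrixPresentation A π := by
  obtain ⟨p, π, hπ⟩ := Module.Finite.exists_fin' R M
  obtain ⟨q, s, hs⟩ := Submodule.fg_iff_exists_fin_generating_family.1
    (IsNoetherian.noetherian (LinearMap.ker π))
  refine ⟨p, q, Matrix.of s, π, hπ, ?_⟩
  rw [← hs, _root_.range_vecMulLinear]
  rfl

end Fitting

/-! ### The group ring of a free abelian group of finite rank -/

/-- A prime ideal of `Q[X]`, with `Q` factorial, which contracts to zero in `Q` is principal. -/
lemma isPrincipal_of_comap_C_eq_bot {Q : Type*} [CommRing Q] [IsDomain Q]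
    [UniqueFactorizationMonoid Q] (P : Ideal (Polynomial Q)) (hP : P.IsPrime)
    (h : ∀ r : Q, Polynomial.C r ∈ P → r = 0) : ∃ f, P = Ideal.span {f} := by
  by_cases hbot : P = ⊥
  · exact ⟨0, by simp [hbot]⟩
  obtain ⟨f, hfP, hf⟩ := hP.exists_mem_prime_of_ne_bot hbot
  have hdeg : f.natDegree ≠ 0 := fun h0 => hf.ne_zero (by
    rw [Polynomial.eq_C_of_natDegree_eq_zero h0] at hfP ⊢
    rw [h _ hfP, map_zero])
  have hprim := hf.irreducible.isPrimitive hdeg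
  let K := FractionRing Q
  have hirr := (hprim.irreducible_iff_irreducible_map_fraction_map (K := K)).1 hf.irreducible
  refine ⟨f, le_antisymm (fun g hg => ?_) ((Ideal.span_singleton_le_iff_mem _).2 hfP)⟩
  rw [Ideal.mem_span_singleton, hprim.dvd_iff_fraction_map_dvd_fraction_map K]
  rcases EuclideanDomain.dvd_or_coprime (Polynomial.map (algebraMap Q K) f)
    (Polynomial.map (algebraMap Q K) g) hirr with hd | ⟨a, b, hab⟩
  · exact hd
  exfalso
  obtain ⟨s, hs, ha⟩ := IsLocalization.integerNormalization_spec (nonZeroDivisors Q) a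
  obtain ⟨t, ht, hb⟩ := IsLocalization.integerNormalization_spec (nonZeroDivisors Q) b
  -- Clearing denominators in the Bézout relation over the fraction field puts a nonzero constant
  -- into P.
  have key : Polynomial.C (s * t) =
      Polynomial.C t * IsLocalization.integerNormalization (nonZeroDivisors Q) a * f +
      Polynomial.C s * IsLocalization.integerNormalization (nonZeroDivisors Q) b * g := by
    apply Polynomial.map_injective _ (IsFractionRing.injective Q K)
    simp only [Polynomial.map_add, Polynomial.map_mul, ha, hb, Polynomial.map_C]
    rw [← algebraMap_smul K s a, ← algebraMap_smul K t b, Polynomial.smul_eq_C_mul,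
      Polynomial.smul_eq_C_mul, map_mul, map_mul, ← mul_one (_ * Polynomial.C _), ← hab]
    ring
  have hmem : Polynomial.C (s * t) ∈ P := by
    rw [key]
    exact add_mem (P.mul_mem_left _ hfP) (P.mul_mem_left _ hg)
  exact mul_ne_zero (nonZeroDivisors.ne_zero hs) (nonZeroDivisors.ne_zero ht) (h _ hmem)

/-- A prime ideal of a polynomial ring which contains no nonzero polynomial in the variables other
than `X i` is principal. -/
lemma isPrincipal_of_rename_eq_zero {σ : Type} [Finite σ] (i : σ)
    (P : Ideal (MvPolynomial σ ℤ)) (hP : P.IsPrime)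
    (h : ∀ q : MvPolynomial {j // j ≠ i} ℤ, MvPolynomial.rename Subtype.val q ∈ P → q = 0) :
    ∃ f, P = Ideal.span {f} := by
  classical
  let e : Polynomial (MvPolynomial {j // j ≠ i} ℤ) ≃ₐ[ℤ] MvPolynomial σ ℤ :=
    (MvPolynomial.optionEquivLeft ℤ {j // j ≠ i}).symm.trans
      (MvPolynomial.renameEquiv ℤ (Equiv.optionSubtypeNe i))
  have he (q : MvPolynomial {j // j ≠ i} ℤ) :
      e (Polynomial.C q) = MvPolynomial.rename Subtype.val q := by
    have : Polynomial.C q =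
        MvPolynomial.optionEquivLeft ℤ {j // j ≠ i} (MvPolynomial.rename some q) := by
      induction q using MvPolynomial.induction_on with
      | C a => simp
      | add p q hp hq => simp [hp, hq]
      | mul_X p j hp => simp [hp]
    rw [this]
    simp only [e, AlgEquiv.trans_apply, AlgEquiv.symm_apply_apply, MvPolynomial.renameEquiv_apply,
      MvPolynomial.rename_rename]
    rfl
  obtain ⟨f, hf⟩ := isPrincipal_of_comap_C_eq_bot (P.comap e) (hP.comap e)
    (fun r hr => h r (by rw [← he]; exact hr))
  refine ⟨e f, ?_⟩
  rw [← Ideal.map_comap_of_surjective e e.surjective P, hf, Ideal.map_span, Set.image_singleton]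

/-! ### The group ring as a localization of a polynomial ring -/

section PolynomialModel

variable {A : Type} [CommGroup A] {σ : Type} (B : Module.Basis σ ℤ (Additive A))

/-- The `i`-th coordinate of a group element with respect to a basis. -/
def coord (i : σ) (a : A) : ℤ := B.repr (Additive.ofMul a) i

@[simp] lemma coord_one (i : σ) : coord B i 1 = 0 := by simp [coord]

@[simp] lemma coord_mul (i : σ) (a b : A) : coord B i (a * b) = coord B i a + coord B i b := by
  simp [coord]

@[simp] lemma coord_inv (i : σ) (a : A) : coord B i a⁻¹ = -coord B i a := by
  simp [coord]

@[simp] lemma coord_zpow (i : σ) (a : A) (n : ℤ) : coord B i (a ^ n) = n * coord B i a := by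
  simp [coord]

lemma coord_ext {a b : A} (h : ∀ i, coord B i a = coord B i b) : a = b :=
  Additive.ofMul.injective (B.repr.injective (Finsupp.ext h))

/-- The group element with given natural coordinates. -/
def groupMonomial (m : σ →₀ ℕ) : A := m.prod fun i k => (B i).toMul ^ k

@[simp] lemma coord_groupMonomial (i : σ) (m : σ →₀ ℕ) : coord B i (groupMonomial B m) = m i := by
  classical
  have : Additive.ofMul (groupMonomial B m) = m.sum fun j k => k • B j := by
    simp [groupMonomial, Finsupp.prod, Finsupp.sum, ofMul_prod]
  rw [coord, this, Finsupp.sum, map_sum, Finsupp.finsetSum_apply]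
  simp +contextual [Finsupp.single_apply]

lemma groupMonomial_injective : Function.Injective (groupMonomial B) := fun m n h =>
  Finsupp.ext fun i => by
    have := congrArg (coord B i) h
    simpa using this

/-- The embedding of the polynomial ring into the group ring given by a basis of the group. -/
def polyMap : MvPolynomial σ ℤ →ₐ[ℤ] MonoidAlgebra ℤ A :=
  MvPolynomial.aeval fun i => MonoidAlgebra.single (B i).toMul 1

lemma polyMap_monomial (m : σ →₀ ℕ) (c : ℤ) :
    polyMap B (MvPolynomial.monomial m c) = MonoidAlgebra.single (groupMonomial B m) c := by
  simp [polyMap, MvPolynomial.aeval_monomial, MonoidAlgebra.single_pow, groupMonomial,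
    Finsupp.prod, MonoidAlgebra.prod_single, MonoidAlgebra.single_mul_single,
    MonoidAlgebra.intCast_def]

lemma coeff_polyMap_groupMonomial (f : MvPolynomial σ ℤ) (m : σ →₀ ℕ) :
    (polyMap B f).coeff (groupMonomial B m) = f.coeff m := by
  classical
  induction f using MvPolynomial.induction_on' with
  | monomial n c =>
    simp [polyMap_monomial, Finsupp.single_apply, MvPolynomial.coeff_monomial,
      (groupMonomial_injective B).eq_iff]
  | add p q hp hq => simp [hp, hq]

lemma exists_of_coeff_polyMap_ne_zero {f : MvPolynomial σ ℤ} {a : A}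
    (h : (polyMap B f).coeff a ≠ 0) : ∃ m ∈ f.support, a = groupMonomial B m := by
  classical
  rw [f.as_sum] at h
  simp only [map_sum, polyMap_monomial, MonoidAlgebra.coeff_sum, Finsupp.finsetSum_apply,
    MonoidAlgebra.coeff_single] at h
  obtain ⟨m, hm, hne⟩ := Finset.exists_ne_zero_of_sum_ne_zero h
  refine ⟨m, hm, ?_⟩
  rw [Finsupp.single_apply] at hne
  split_ifs at hne with e
  · exact e.symm
  · exact absurd rfl hne

lemma polyMap_injective : Function.Injective (polyMap B) := by
  refine (injective_iff_map_eq_zero _).2 fun f hf => MvPolynomial.ext _ _ fun m => ?_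
  rw [← coeff_polyMap_groupMonomial B, hf]
  simp

lemma isUnit_polyMap_monomial (m : σ →₀ ℕ) :
    IsUnit (polyMap B (MvPolynomial.monomial m 1)) := by
  rw [polyMap_monomial]
  refine IsUnit.of_mul_eq_one (MonoidAlgebra.single (groupMonomial B m)⁻¹ 1) ?_
  simp [MonoidAlgebra.single_mul_single, MonoidAlgebra.one_def]

variable [Finite σ]

lemma exists_polyMap_eq_mul (r : MonoidAlgebra ℤ A) :
    ∃ (m : σ →₀ ℕ) (f : MvPolynomial σ ℤ),
      polyMap B f = polyMap B (MvPolynomial.monomial m 1) * r := by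
  induction r using MonoidAlgebra.induction_linear with
  | zero => exact ⟨0, 0, by simp⟩
  | add r s hr hs =>
    obtain ⟨m, f, hf⟩ := hr
    obtain ⟨n, g, hg⟩ := hs
    refine ⟨m + n, MvPolynomial.monomial n 1 * f + MvPolynomial.monomial m 1 * g, ?_⟩
    have : MvPolynomial.monomial (m + n) (1 : ℤ) =
      MvPolynomial.monomial m 1 * MvPolynomial.monomial n 1 := by simp [MvPolynomial.monomial_mul]
    rw [this]
    simp only [map_add, map_mul, hf, hg]
    ring
  | single a c =>
    -- The negative and positive parts of the exponents of a.
    let m : σ →₀ ℕ := Finsupp.equivFunOnFinite.symm fun i => (-coord B i a).toNat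
    let n : σ →₀ ℕ := Finsupp.equivFunOnFinite.symm fun i => (coord B i a).toNat
    refine ⟨m, MvPolynomial.monomial n c, ?_⟩
    rw [polyMap_monomial, polyMap_monomial, MonoidAlgebra.single_mul_single, one_mul]
    congr 1
    refine coord_ext B fun i => ?_
    simp only [coord_groupMonomial, coord_mul, m, n, Finsupp.equivFunOnFinite_symm_apply_apply]
    omega

lemma uniqueFactorizationMonoid_of_basis (B : Module.Basis σ ℤ (Additive A)) :
    UniqueFactorizationMonoid (MonoidAlgebra ℤ A) := by
  let _ : Algebra (MvPolynomial σ ℤ) (MonoidAlgebra ℤ A) := (polyMap B).toRingHom.toAlgebra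
  have halg (f : MvPolynomial σ ℤ) : algebraMap _ (MonoidAlgebra ℤ A) f = polyMap B f := rfl
  have : IsLocalization ((IsUnit.submonoid (MonoidAlgebra ℤ A)).comap (polyMap B))
      (MonoidAlgebra ℤ A) :=
    { map_units := fun y => y.2
      surj := fun r => by
        obtain ⟨m, f, hf⟩ := exists_polyMap_eq_mul B r
        exact ⟨⟨f, MvPolynomial.monomial m 1, isUnit_polyMap_monomial B m⟩, by
          rw [halg, halg, hf, mul_comm]⟩
      exists_of_eq := fun {x y} h => ⟨1, by rw [polyMap_injective B h]⟩ }
  exact UniqueFactorizationMonoid.of_isLocalization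
    ((IsUnit.submonoid (MonoidAlgebra ℤ A)).comap (polyMap B)) _

/-- A prime ideal of the group ring which contains no nonzero element supported on a coordinate
hyperplane is principal. -/
lemma isPrincipal_of_forall_coord_eq_zero (i : σ) (P : Ideal (MonoidAlgebra ℤ A)) (hP : P.IsPrime)
    (h : ∀ r ∈ P, (∀ a, r.coeff a ≠ 0 → coord B i a = 0) → r = 0) :
    ∃ f, P = Ideal.span {f} := by
  obtain ⟨f, hf⟩ := isPrincipal_of_rename_eq_zero i (P.comap (polyMap B)) (hP.comap _)
    (fun q hq => by
      classical
      have := h _ hq (fun a ha => by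
        obtain ⟨m, hm, rfl⟩ := exists_of_coeff_polyMap_ne_zero B ha
        rw [coord_groupMonomial]
        have hv := MvPolynomial.vars_rename Subtype.val q
        by_contra h0
        have : i ∈ (MvPolynomial.rename Subtype.val q).vars :=
          (MvPolynomial.mem_vars_iff_mem_support _).2 ⟨m, hm, by simpa using h0⟩
        obtain ⟨j, -, hj⟩ := Finset.mem_image.1 (hv this)
        exact j.2 hj)
      have h0 := (map_eq_zero_iff _ (polyMap_injective B)).1 this
      exact (map_eq_zero_iff _ (MvPolynomial.rename_injective _ Subtype.val_injective)).1 h0)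
  have hfP : polyMap B f ∈ P := by
    change f ∈ P.comap (polyMap B)
    rw [hf]
    exact Ideal.mem_span_singleton_self f
  refine ⟨polyMap B f, le_antisymm (fun r hr => ?_) ((Ideal.span_singleton_le_iff_mem _).2 hfP)⟩
  obtain ⟨m, g, hg⟩ := exists_polyMap_eq_mul B r
  have hgP : g ∈ P.comap (polyMap B) := by
    change polyMap B g ∈ P
    rw [hg]
    exact P.mul_mem_left _ hr
  rw [hf, Ideal.mem_span_singleton] at hgP
  have := map_dvd (polyMap B) hgP
  rw [hg] at this
  exact Ideal.mem_span_singleton.2 ((isUnit_polyMap_monomial B m).dvd_mul_left.1 this)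

end PolynomialModel

/-! ### Finitely generated groups of real numbers -/

section RealGroups

variable {A : Type} [CommGroup A] {v : A →* Multiplicative ℝ}

lemma isMulTorsionFree_of_injective (hv : Function.Injective v) : IsMulTorsionFree A :=
  Function.Injective.isMulTorsionFree v hv

lemma exists_basis [Group.FG A] (hv : Function.Injective v) :
    ∃ n : ℕ, Nonempty (Module.Basis (Fin n) ℤ (Additive A)) := by
  have := isMulTorsionFree_of_injective hv
  have : Module.Free ℤ (Additive A) := Module.free_of_finite_type_torsion_free'
  exact ⟨_, ⟨Module.finBasis ℤ (Additive A)⟩⟩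

lemma uniqueFactorizationMonoid_of_injective [Group.FG A] (hv : Function.Injective v) :
    UniqueFactorizationMonoid (MonoidAlgebra ℤ A) := by
  obtain ⟨n, ⟨B⟩⟩ := exists_basis hv
  exact uniqueFactorizationMonoid_of_basis B

lemma isNoetherianRing_monoidAlgebra [Group.FG A] : IsNoetherianRing (MonoidAlgebra ℤ A) :=
  Algebra.FiniteType.isNoetherianRing ℤ _

end RealGroups

/-- Every ideal of a Noetherian factorial ring has a greatest common divisor. -/
lemma exists_isGcdOfIdeal {R : Type*} [CommRing R] [IsDomain R] [UniqueFactorizationMonoid R]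
    [IsNoetherianRing R] (I : Ideal R) : ∃ d, IsGcdOfIdeal I d := by
  classical
  let _ := UniqueFactorizationMonoid.strongNormalizationMonoid (α := R)
  let _ := UniqueFactorizationMonoid.toNormalizedGCDMonoid R
  obtain ⟨s, hs⟩ := IsNoetherian.noetherian I
  refine ⟨s.gcd id, fun a => ?_⟩
  rw [Finset.dvd_gcd_iff]
  constructor
  · intro h x hx
    rw [← Ideal.mem_span_singleton]
    rw [← hs] at hx
    refine Submodule.span_le.2 (fun y hy => ?_) hx
    exact Ideal.mem_span_singleton.2 (h y hy)
  · intro h y hy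
    exact h y (hs ▸ Submodule.subset_span hy)

/-! ### Prime ideals without monic elements -/

section Primes

variable {A : Type} [CommGroup A] {v : A →* Multiplicative ℝ}

lemma exists_eq_natCast_mul (p : ℕ) (f : MonoidAlgebra ℤ A) :
    ∃ g h : MonoidAlgebra ℤ A, f = (p : MonoidAlgebra ℤ A) * g + h ∧
      ∀ a, h.coeff a ≠ 0 → ¬ (p : ℤ) ∣ h.coeff a := by
  classical
  refine ⟨.ofCoeff (f.coeff.mapRange (fun c => c / p) (by simp)),
    .ofCoeff (f.coeff.mapRange (fun c => c % p) (by simp)), ?_, ?_⟩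
  · refine MonoidAlgebra.ext (Finsupp.ext fun a => ?_)
    have := MonoidAlgebra.coeff_single_one_mul (M := A)
      (.ofCoeff (f.coeff.mapRange (fun c => c / (p : ℤ)) (by simp))) (p : ℤ) a
    rw [MonoidAlgebra.natCast_def, MonoidAlgebra.coeff_add, Finsupp.add_apply]
    refine Eq.trans ?_ (congrArg (· + _) this.symm)
    simp [Int.mul_ediv_add_emod]
  · intro a ha hd
    simp only [Finsupp.mapRange_apply] at ha hd
    exact ha (by simpa using Int.emod_eq_zero_of_dvd hd)

/-- An ideal without monic elements which contains a prime number is generated by it. -/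
lemma eq_span_of_natCast_mem (hv : Function.Injective v) (P : Ideal (MonoidAlgebra ℤ A))
    (hS : ∀ r ∈ P, ¬ IsMonic v r) {p : ℕ} (hp : p.Prime) (hpP : (p : MonoidAlgebra ℤ A) ∈ P) :
    P = Ideal.span {(p : MonoidAlgebra ℤ A)} := by
  refine le_antisymm (fun f hf => ?_) ((Ideal.span_singleton_le_iff_mem _).2 hpP)
  obtain ⟨g, h, rfl, hh⟩ := exists_eq_natCast_mul p f
  have hhP : h ∈ P := (Ideal.add_mem_iff_right _ (P.mul_mem_right _ hpP)).1 hf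
  suffices h = 0 by
    rw [this, add_zero]
    exact Ideal.mul_mem_right _ _ (Ideal.mem_span_singleton_self _)
  by_contra hne
  obtain ⟨a, ha⟩ := exists_isInitial hv hne
  have hcop : IsCoprime (h.coeff a) (p : ℤ) :=
    ((Nat.prime_iff_prime_int.1 hp).coprime_iff_not_dvd.2 (hh a ha.1)).symm
  -- Scaling h by x and adding a multiple of p at a alone turns the initial coefficient into 1 and
  -- creates no new support.
  obtain ⟨x, y, hxy⟩ := hcop
  refine hS (MonoidAlgebra.single 1 x * h + (p : MonoidAlgebra ℤ A) * MonoidAlgebra.single a y)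
    (add_mem (P.mul_mem_left _ hhP) (P.mul_mem_right _ hpP)) ?_
  have hcoeff (b : A) : (MonoidAlgebra.single 1 x * h +
      (p : MonoidAlgebra ℤ A) * MonoidAlgebra.single a y).coeff b =
      x * h.coeff b + (MonoidAlgebra.single a (y * (p : ℤ))).coeff b := by
    rw [MonoidAlgebra.natCast_def, MonoidAlgebra.single_mul_single, MonoidAlgebra.coeff_add,
      Finsupp.add_apply, MonoidAlgebra.coeff_single_one_mul, one_mul, mul_comm y]
  refine ⟨a, Or.inl ?_, fun b hba hb => ?_⟩
  · rw [hcoeff]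
    simpa using hxy
  · refine ha.2 b hba fun h0 => hb ?_
    rw [hcoeff, h0]
    simp [hba.symm]

variable {K : Type} [Field K]

/-- If an ideal contains no monic element, a field containing the quotient carries a valuation
which is small on the group elements with positive `v`. -/
lemma exists_valuationSubring (hv : Function.Injective v) (f : MonoidAlgebra ℤ A →+* K)
    (hS : ∀ r, f r = 0 → ¬ IsMonic v r) :
    ∃ V : ValuationSubring K, ∀ a : A, 0 < (v a).toAdd →
      V.valuation (f (MonoidAlgebra.single a 1)) < 1 := by
  classical
  let f' : nonnegSubring v →+* K := f.comp (nonnegSubring v).subtype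
  let I : Ideal f'.range := (RingHom.ker (constCoeff hv)).map f'.rangeRestrict
  -- If 1 were the image of some y with zero constant coefficient, the monic element 1 - y would lie
  -- in the kernel. A proper ideal of a subring of K is contained in the nonunits of some valuation
  -- ring.
  have hI : I ≠ ⊤ := by
    rw [Ne, Ideal.eq_top_iff_one,
      Ideal.mem_map_iff_of_surjective _ f'.rangeRestrict_surjective]
    rintro ⟨y, hy, h1⟩
    have h1' : f' y = 1 := congrArg Subtype.val h1
    refine hS (1 - y : nonnegSubring v).1 ?_ (isMonic_of_isUnit_constCoeff hv (1 - y) ?_)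
    · change f' (1 - y) = 0
      rw [map_sub, h1', map_one, sub_self]
    · rw [map_sub, (RingHom.mem_ker).1 hy, map_one, sub_zero]
      exact isUnit_one
  obtain ⟨V, hV, hIV⟩ := I.image_subset_nonunits_valuationSubring hI
  refine ⟨V, fun a ha => ?_⟩
  let y : nonnegSubring v := ⟨MonoidAlgebra.single a 1, fun g hg => by
    rw [MonoidAlgebra.coeff_single, Finsupp.single_apply] at hg
    split_ifs at hg with e
    · rw [← e]; exact ha.le
    · exact absurd rfl hg⟩
  have hy : y ∈ RingHom.ker (constCoeff hv) := by
    rw [RingHom.mem_ker, constCoeff_apply, MonoidAlgebra.coeff_single, Finsupp.single_apply,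
      if_neg]
    rintro rfl
    simp at ha
  have := hIV ⟨f'.rangeRestrict y, Ideal.mem_map_of_mem _ hy, rfl⟩
  exact (ValuationSubring.mem_nonunits_iff _).1 this

variable {Γ : Type} [LinearOrderedCommGroupWithZero Γ]

/-- If the terms of `r` have pairwise distinct valuations, then `r` does not vanish. -/
lemma map_ne_zero_of_valuation_injOn (w : Valuation K Γ) (f : MonoidAlgebra ℤ A →+* K)
    {r : MonoidAlgebra ℤ A} (hr : r ≠ 0)
    (h0 : ∀ a, r.coeff a ≠ 0 → f (MonoidAlgebra.single a (r.coeff a)) ≠ 0)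
    (h : ∀ a b, r.coeff a ≠ 0 → r.coeff b ≠ 0 →
      w (f (MonoidAlgebra.single a (r.coeff a))) = w (f (MonoidAlgebra.single b (r.coeff b))) →
      a = b) : f r ≠ 0 := by
  classical
  obtain ⟨a, ha, hmax⟩ := Finset.exists_max_image r.coeff.support
    (fun a => w (f (MonoidAlgebra.single a (r.coeff a))))
    (Finsupp.support_nonempty_iff.2 (by simpa using hr))
  have hsum : f r = ∑ b ∈ r.coeff.support, f (MonoidAlgebra.single b (r.coeff b)) := by
    conv_lhs => rw [← MonoidAlgebra.sum_coeff_single r]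
    rw [Finsupp.sum, map_sum]
  have hw := w.map_sum_eq_of_lt (s := r.coeff.support) (j := a)
    (f := fun b => f (MonoidAlgebra.single b (r.coeff b))) ha
    (fun b hb => by
      obtain ⟨hb, hne⟩ := Finset.mem_sdiff.1 hb
      refine lt_of_le_of_ne (hmax b hb) fun e => hne ?_
      rw [Finset.mem_singleton]
      exact h b a (by simpa using hb) (by simpa using ha) e)
  intro hz
  rw [← hsum, hz, map_zero] at hw
  exact (Valuation.ne_zero_iff _).2 (h0 a (by simpa using ha)) hw.symm

/-- A valuation on a field of characteristic zero takes on the integers the powers of a single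
value. -/
lemma exists_valuation_intCast_eq_pow [CharZero K] (w : Valuation K Γ) :
    ∃ ϖ : Γ, ϖ ≠ 0 ∧ ∀ c : ℤ, c ≠ 0 → ∃ n : ℕ, w (c : K) = ϖ ^ n := by
  have hle (c : ℤ) : w (c : K) ≤ 1 := by
    have hnat (n : ℕ) : w (n : K) ≤ 1 := by
      induction n with
      | zero => simp
      | succ n ih =>
        rw [Nat.cast_add]
        exact w.map_add_le ih (by simp)
    obtain ⟨n, rfl | rfl⟩ := c.eq_nat_or_neg
    · exact_mod_cast hnat n
    · rw [Int.cast_neg, Valuation.map_neg]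
      exact_mod_cast hnat n
  -- The integers of value below 1 form a prime ideal. Its generator supplies ϖ, unless it is zero,
  -- when all nonzero integers have value 1.
  let I : Ideal ℤ :=
    { carrier := {c | w (c : K) < 1}
      zero_mem' := by simp
      add_mem' := fun {a b} ha hb => by
        simp only [Set.mem_ofPred_eq, Int.cast_add]
        exact w.map_add_lt ha hb
      smul_mem' := fun c a ha => by
        simp only [Set.mem_ofPred_eq, smul_eq_mul, Int.cast_mul, map_mul] at ha ⊢
        exact mul_lt_one_of_nonneg_of_lt_one_right (hle c) zero_le ha }
  have hIp : I.IsPrime := by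
    refine ⟨(Ideal.ne_top_iff_one I).2 (by simp [I]), fun {a b} hab => ?_⟩
    by_contra! h
    have ha : w (a : K) = 1 := le_antisymm (hle a) (not_lt.1 h.1)
    have hb : w (b : K) = 1 := le_antisymm (hle b) (not_lt.1 h.2)
    have : w ((a * b : ℤ) : K) < 1 := hab
    rw [Int.cast_mul, map_mul, ha, hb, mul_one] at this
    exact lt_irrefl _ this
  have hnot (c : ℤ) (hc : c ∉ I) : w (c : K) = 1 := le_antisymm (hle c) (not_lt.1 hc)
  let p := Submodule.IsPrincipal.generator I
  have hpI (c : ℤ) : c ∈ I ↔ p ∣ c := Submodule.IsPrincipal.mem_iff_generator_dvd I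
  by_cases hp0 : p = 0
  · refine ⟨1, one_ne_zero, fun c hc => ⟨0, ?_⟩⟩
    rw [pow_zero]
    exact hnot c fun h => hc (by rwa [hpI, hp0, zero_dvd_iff] at h)
  have hpu : ¬ IsUnit p := fun h => hIp.ne_top (by
    rw [← Ideal.span_singleton_generator I]
    exact Ideal.span_singleton_eq_top.2 h)
  refine ⟨w (p : K), by simpa using hp0, fun c hc => ?_⟩
  obtain ⟨d, hcd, hd⟩ := (Int.finiteMultiplicity_iff.2
    ⟨fun h => hpu (Int.isUnit_iff_natAbs_eq.2 h), hc⟩).exists_eq_pow_mul_and_not_dvd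
  refine ⟨multiplicity p c, (congrArg (fun x : ℤ => w (x : K)) hcd).trans ?_⟩
  rw [Int.cast_mul, map_mul, hnot d (by rwa [hpI]), mul_one, Int.cast_pow, map_pow]

/-- A prime ideal without monic elements is principal. -/
theorem isPrincipal_of_forall_not_isMonic [Group.FG A] (hv : Function.Injective v)
    (P : Ideal (MonoidAlgebra ℤ A)) (hP : P.IsPrime) (hS : ∀ r ∈ P, ¬ IsMonic v r) :
    ∃ f, P = Ideal.span {f} := by
  classical
  obtain ⟨n, ⟨B⟩⟩ := exists_basis hv
  by_cases hchar : ∃ c : ℤ, c ≠ 0 ∧ (c : MonoidAlgebra ℤ A) ∈ P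
  · obtain ⟨c, hc, hcP⟩ := hchar
    have hprime : (P.comap (Int.castRingHom (MonoidAlgebra ℤ A))).IsPrime := hP.comap _
    obtain ⟨p, hpP, hp⟩ := hprime.exists_mem_prime_of_ne_bot
      (fun h => hc (by
        have : c ∈ P.comap (Int.castRingHom (MonoidAlgebra ℤ A)) := hcP
        rwa [h] at this))
    refine ⟨_, eq_span_of_natCast_mem hv P hS (Int.prime_iff_natAbs_prime.1 hp) ?_⟩
    have hpP' : (p : MonoidAlgebra ℤ A) ∈ P := hpP
    rcases Int.natAbs_eq p with h | h <;> rw [h] at hpP'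
    · rwa [Int.cast_natCast] at hpP'
    · rwa [Int.cast_neg, neg_mem_iff, Int.cast_natCast] at hpP'
  push Not at hchar
  let D := MonoidAlgebra ℤ A ⧸ P
  let K := FractionRing D
  let f : MonoidAlgebra ℤ A →+* K := (algebraMap D K).comp (Ideal.Quotient.mk P)
  have hker (r : MonoidAlgebra ℤ A) : f r = 0 ↔ r ∈ P := by
    rw [← Ideal.Quotient.eq_zero_iff_mem]
    exact map_eq_zero_iff (algebraMap D K) (IsFractionRing.injective D K)
  obtain ⟨V, hV⟩ := exists_valuationSubring hv f (fun r hr => hS r ((hker r).1 hr))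
  have hcast (c : ℤ) : (c : K) = f (c : MonoidAlgebra ℤ A) := (map_intCast f c).symm
  have : CharZero K := by
    refine charZero_of_inj_zero fun m hm => ?_
    by_contra h
    refine hchar m (by exact_mod_cast h) ((hker _).1 ?_)
    rw [← hcast]
    exact_mod_cast hm
  let w := V.valuation
  let χ : A →* K := f.toMonoidHom.comp (MonoidAlgebra.of ℤ A)
  have hχ0 (a : A) : χ a ≠ 0 := ((Group.isUnit a).map χ).ne_zero
  have hχlt (a : A) (ha : 0 < (v a).toAdd) : w (χ a) < 1 := hV a ha
  have hχone (a : A) (ha : w (χ a) = 1) : a = 1 := by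
    rcases lt_trichotomy (v a).toAdd 0 with h | h | h
    · have := hχlt a⁻¹ (by simpa using h)
      have h1 : w (χ a) * w (χ a⁻¹) = 1 := by
        rw [← map_mul, ← map_mul, mul_inv_cancel, map_one, map_one]
      rw [ha, one_mul] at h1
      exact absurd h1 this.ne
    · exact hv (Multiplicative.toAdd.injective (by simpa using h))
    · exact absurd ha (hχlt a h).ne
  have hsingle (a : A) (c : ℤ) : f (MonoidAlgebra.single a c) = (c : K) * χ a := by
    have : MonoidAlgebra.single a c = (c : MonoidAlgebra ℤ A) * MonoidAlgebra.single a 1 := by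
      rw [MonoidAlgebra.intCast_def, MonoidAlgebra.single_mul_single]
      simp
    rw [this, map_mul, hcast]
    rfl
  obtain ⟨ϖ, hϖ0, hϖ⟩ := exists_valuation_intCast_eq_pow w
  -- ratios of group elements which occur with terms of equal valuation
  let Tie : A → Prop := fun a => ∃ k : ℤ, w (χ a) = ϖ ^ k
  have htie (a b : A) (c d : ℤ) (hc : c ≠ 0) (hd : d ≠ 0)
      (h : w (f (MonoidAlgebra.single a c)) = w (f (MonoidAlgebra.single b d))) :
      Tie (a / b) := by
    obtain ⟨i, hi⟩ := hϖ c hc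
    obtain ⟨j, hj⟩ := hϖ d hd
    rw [hsingle, hsingle, map_mul, map_mul, hi, hj] at h
    refine ⟨j - i, ?_⟩
    have hb : w (χ b) ≠ 0 := (Valuation.ne_zero_iff _).2 (hχ0 b)
    have : w (χ (a / b)) * w (χ b) = w (χ a) := by rw [← map_mul, ← map_mul, div_mul_cancel]
    rw [zpow_sub₀ hϖ0, zpow_natCast, zpow_natCast, eq_div_iff (pow_ne_zero _ hϖ0)]
    apply mul_right_cancel₀ hb
    rw [mul_right_comm, this, mul_comm, h]
  -- it suffices to exclude coincidences on a coordinate hyperplane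
  have hmain (i : Fin n) (hi : ∀ a, coord B i a = 0 → Tie a → a = 1) :
      ∃ f, P = Ideal.span {f} := by
    refine isPrincipal_of_forall_coord_eq_zero B i P hP fun r hrP hr => ?_
    by_contra hr0
    refine map_ne_zero_of_valuation_injOn w f hr0 (fun a ha => ?_) (fun a b ha hb h => ?_)
      ((hker r).2 hrP)
    · rw [hsingle]
      exact mul_ne_zero (by exact_mod_cast ha) (hχ0 a)
    · refine div_eq_one.1 (hi _ ?_ (htie a b _ _ ha hb h))
      rw [div_eq_mul_inv, coord_mul, coord_inv, hr a ha, hr b hb]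
      simp
  by_cases hT : ∃ a, Tie a ∧ a ≠ 1
  · obtain ⟨a, ⟨k, hk⟩, ha⟩ := hT
    obtain ⟨i, hi⟩ : ∃ i, coord B i a ≠ 0 := by
      by_contra! h
      exact ha (coord_ext B fun i => by rw [h i, coord_one])
    refine hmain i fun b hb ⟨l, hl⟩ => ?_
    -- Both sides have value ϖ ^ (k * l), and only 1 has value 1. Comparing i-th coordinates then
    -- forces l = 0.
    have hab : a ^ l = b ^ k := by
      refine div_eq_one.1 (hχone _ ?_)
      have h1 : w (χ (a ^ l)) = w (χ (b ^ k)) := by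
        rw [map_zpow, map_zpow, map_zpow₀, map_zpow₀, hk, hl, ← zpow_mul, ← zpow_mul, mul_comm]
      rw [map_div, map_div₀, h1, div_self ((Valuation.ne_zero_iff _).2 (hχ0 _))]
    have h2 := congrArg (coord B i) hab
    rw [coord_zpow, coord_zpow, hb, mul_zero] at h2
    have hl0 : l = 0 := (mul_eq_zero.1 h2).resolve_right hi
    exact hχone b (by rw [hl, hl0, zpow_zero])
  · push Not at hT
    rcases Nat.eq_zero_or_pos n with h0 | h0
    · have hone (a : A) : a = 1 := coord_ext B fun i => by subst h0; exact i.elim0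
      refine ⟨0, ?_⟩
      rw [Ideal.span_singleton_zero, eq_bot_iff]
      intro r hr
      have hr' : r = ((r.coeff 1 : ℤ) : MonoidAlgebra ℤ A) := by
        refine MonoidAlgebra.ext (Finsupp.ext fun a => ?_)
        rw [hone a, MonoidAlgebra.intCast_def]
        simp
      by_contra hne
      refine hchar (r.coeff 1) (fun h => hne ?_) (hr' ▸ hr)
      rw [Ideal.mem_bot, hr', h, Int.cast_zero]
    · exact hmain ⟨0, h0⟩ fun a _ => hT a

/-- A greatest common divisor of an ideal is monic if and only if the ideal contains a monic
element. -/
theorem IsGcdOfIdeal.isMonic_iff [Group.FG A] (hv : Function.Injective v)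
    {I : Ideal (MonoidAlgebra ℤ A)} {d : MonoidAlgebra ℤ A} (hd : IsGcdOfIdeal I d) :
    IsMonic v d ↔ ∃ s ∈ I, IsMonic v s := by
  constructor
  · intro h
    by_contra! hI
    obtain ⟨P, hP, hIP, hdis⟩ := Ideal.exists_le_prime_disjoint I (monicSubmonoid hv)
      (Set.disjoint_left.2 hI)
    obtain ⟨f, hf⟩ := isPrincipal_of_forall_not_isMonic hv P hP
      (fun r hr hm => Set.disjoint_left.1 hdis hr hm)
    have hfd : f ∣ d := (hd f).2 fun x hx => by
      rw [← Ideal.mem_span_singleton, ← hf]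
      exact hIP hx
    rw [← Ideal.mem_span_singleton, ← hf] at hfd
    exact Set.disjoint_left.1 hdis hfd h
  · rintro ⟨s, hs, hm⟩
    obtain ⟨c, rfl⟩ := (hd d).1 dvd_rfl s hs
    exact ((isMonic_mul_iff hv).1 hm).1

end Primes

/-! ### The Novikov completion as a module over the group ring -/

section NovikovModule

variable {A : Type} [CommGroup A] {v : A →* Multiplicative ℝ}

variable (v) in
/-- The Novikov completion, as a module over the group ring. -/
abbrev NovikovModule : Type := (novikovRep v).asModule

/-- The coefficients of an element of the Novikov completion. -/
def novCoeff : NovikovModule v →+ (A → ℤ) := (novikov v).subtype.toAddMonoidHom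

lemma novCoeff_injective : Function.Injective (novCoeff (v := v)) := Subtype.val_injective

lemma finite_novCoeff (x : NovikovModule v) (C : ℝ) :
    {g : A | novCoeff x g ≠ 0 ∧ (v g).toAdd ≤ C}.Finite :=
  (show novikov v from x).2 C

/-- The element of the Novikov completion with given coefficients. -/
def novMk (f : A → ℤ) (hf : ∀ C : ℝ, {g : A | f g ≠ 0 ∧ (v g).toAdd ≤ C}.Finite) :
    NovikovModule v := (⟨f, hf⟩ : novikov v)

@[simp] lemma novCoeff_novMk (f : A → ℤ)
    (hf : ∀ C : ℝ, {g : A | f g ≠ 0 ∧ (v g).toAdd ≤ C}.Finite) :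
    novCoeff (novMk f hf) = f := rfl

lemma novCoeff_single_smul (a : A) (c : ℤ) (x : NovikovModule v) (g : A) :
    novCoeff (MonoidAlgebra.single a c • x) g = c * novCoeff x (a⁻¹ * g) := by
  have h : MonoidAlgebra.single a c • x = c • (MonoidAlgebra.single a (1 : ℤ) • x) := by
    rw [Representation.single_smul, Representation.single_smul, one_smul]
    rfl
  have h2 : novCoeff (MonoidAlgebra.single a (1 : ℤ) • x) g = novCoeff x (a⁻¹ * g) := by
    rw [Representation.single_smul, one_smul]
    rfl
  rw [h, map_zsmul, Pi.smul_apply, h2, smul_eq_mul]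

lemma novCoeff_smul (r : MonoidAlgebra ℤ A) (x : NovikovModule v) (g : A) :
    novCoeff (r • x) g = ∑ a ∈ r.coeff.support, r.coeff a * novCoeff x (a⁻¹ * g) := by
  conv_lhs => rw [← MonoidAlgebra.sum_coeff_single r]
  rw [Finsupp.sum, Finset.sum_smul, map_sum, Finset.sum_apply]
  simp only [novCoeff_single_smul]

lemma exists_of_novCoeff_smul_ne_zero {r : MonoidAlgebra ℤ A} {x : NovikovModule v} {g : A}
    (h : novCoeff (r • x) g ≠ 0) :
    ∃ a b, r.coeff a ≠ 0 ∧ novCoeff x b ≠ 0 ∧ a * b = g := by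
  rw [novCoeff_smul] at h
  obtain ⟨a, -, ha⟩ := Finset.exists_ne_zero_of_sum_ne_zero h
  exact ⟨a, a⁻¹ * g, left_ne_zero_of_mul ha, right_ne_zero_of_mul ha, mul_inv_cancel_left _ _⟩

variable (v) in
/-- The embedding of the group ring into its Novikov completion. -/
def toNovikov : MonoidAlgebra ℤ A →ₗ[MonoidAlgebra ℤ A] NovikovModule v :=
  LinearMap.toSpanSingleton _ _ (novMk (fun g => (1 : MonoidAlgebra ℤ A).coeff g) fun _ =>
    ((1 : MonoidAlgebra ℤ A).coeff.support.finite_toSet).subset fun _ hg =>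
      Finsupp.mem_support_iff.2 hg.1)

@[simp] lemma novCoeff_toNovikov (r : MonoidAlgebra ℤ A) (g : A) :
    novCoeff (toNovikov v r) g = r.coeff g := by
  classical
  rw [toNovikov, LinearMap.toSpanSingleton_apply, novCoeff_smul, novCoeff_novMk]
  simp only [MonoidAlgebra.one_def, MonoidAlgebra.coeff_single, Finsupp.single_apply,
    eq_inv_mul_iff_mul_eq, mul_one]
  simp [eq_comm]

lemma toNovikov_injective : Function.Injective (toNovikov v) :=
  (injective_iff_map_eq_zero _).2 fun r hr => MonoidAlgebra.ext (Finsupp.ext fun g => by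
    rw [← novCoeff_toNovikov (v := v), hr]
    simp)

/-- The part of a series consisting of the terms where `v` is at most `C`. -/
def truncate (C : ℝ) (x : NovikovModule v) : MonoidAlgebra ℤ A :=
  .ofCoeff (Finsupp.ofSupportFinite (fun g => by
    classical exact if (v g).toAdd ≤ C then novCoeff x g else 0)
    ((finite_novCoeff x C).subset fun g hg => by
      simp only [Function.mem_support, ne_eq, ite_eq_right_iff, Classical.not_imp] at hg
      exact ⟨hg.2, hg.1⟩))

lemma truncate_coeff (C : ℝ) (x : NovikovModule v) (g : A) [Decidable ((v g).toAdd ≤ C)] :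
    (truncate C x).coeff g = if (v g).toAdd ≤ C then novCoeff x g else 0 := by
  simp only [truncate, MonoidAlgebra.coeff_ofCoeff, Finsupp.ofSupportFinite_coe]
  congr

lemma truncate_zero (C : ℝ) : truncate C (0 : NovikovModule v) = 0 := by
  classical
  refine MonoidAlgebra.ext (Finsupp.ext fun g => ?_)
  rw [truncate_coeff]
  simp

variable (v) in
/-- The families of elements of the Novikov completion which tend to zero. -/
def nullFamilies : Submodule (MonoidAlgebra ℤ A) (ℝ → NovikovModule v) where
  carrier := {x | ∀ B : ℝ, ∀ᶠ C in Filter.atTop, ∀ g, novCoeff (x C) g ≠ 0 → B ≤ (v g).toAdd}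
  zero_mem' B := by simp
  add_mem' {x y} hx hy B := by
    filter_upwards [hx B, hy B] with C h1 h2 g hg
    by_cases h : novCoeff (x C) g = 0
    · exact h2 g fun h' => hg (by simp [h, h'])
    · exact h1 g h
  smul_mem' r x hx B := by
    have : ∀ᶠ C in Filter.atTop, ∀ a ∈ r.coeff.support, ∀ g, novCoeff (x C) g ≠ 0 →
        B - (v a).toAdd ≤ (v g).toAdd :=
      (Filter.eventually_all_finset _).2 fun a _ => hx _
    filter_upwards [this] with C h g hg
    obtain ⟨a, b, ha, hb, rfl⟩ := exists_of_novCoeff_smul_ne_zero hg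
    have := h a (by simpa using ha) b hb
    simp only [map_mul, toAdd_mul]
    linarith

lemma sub_truncate_mem_nullFamilies (x : NovikovModule v) :
    (fun C => x - toNovikov v (truncate C x)) ∈ nullFamilies v := by
  classical
  intro B
  filter_upwards [Filter.eventually_ge_atTop B] with C hC g hg
  rw [map_sub, Pi.sub_apply, novCoeff_toNovikov, truncate_coeff] at hg
  split_ifs at hg with h
  · exact absurd (sub_self _) hg
  · linarith

/-- A nonzero series has a term of least v, by finiteness of its support below any level; its
product with the initial term of s cannot cancel. -/
lemma smul_eq_zero_of_isMonic {s : MonoidAlgebra ℤ A}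
    (hs : IsMonic v s) {x : NovikovModule v} (h : s • x = 0) : x = 0 := by
  classical
  by_contra hx
  obtain ⟨g, hg⟩ : ∃ g, novCoeff x g ≠ 0 := by
    by_contra! h0
    exact hx (novCoeff_injective (funext h0))
  obtain ⟨b, ⟨hb, -⟩, hmin⟩ := Set.exists_min_image _ (fun b => (v b).toAdd)
    (finite_novCoeff x (v g).toAdd) ⟨g, hg, le_rfl⟩
  have hmin' (b' : A) (hb' : novCoeff x b' ≠ 0) : (v b).toAdd ≤ (v b').toAdd := by
    by_cases hle : (v b').toAdd ≤ (v g).toAdd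
    · exact hmin b' ⟨hb', hle⟩
    · exact (hmin g ⟨hg, le_rfl⟩).trans (not_le.1 hle).le
  obtain ⟨a, ha, hau⟩ := isMonic_iff.1 hs
  have key : novCoeff (s • x) (a * b) = s.coeff a * novCoeff x b := by
    rw [novCoeff_smul, Finset.sum_eq_single a]
    · rw [inv_mul_cancel_left]
    · intro c hc hca
      by_contra hne
      have h1 := ha.2 c hca (by simpa using hc)
      have h2 := hmin' _ (right_ne_zero_of_mul hne)
      simp only [map_mul, map_inv, toAdd_mul, toAdd_inv] at h2
      linarith
    · intro h0
      exact absurd (by simpa using h0) ha.1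
  rw [h] at key
  exact mul_ne_zero ha.1 hb (by simpa using key.symm)

/-- Multiplication by `1 - y` is surjective on the Novikov completion if all terms of `y` have
positive `v`. -/
lemma exists_one_sub_smul_eq {y : MonoidAlgebra ℤ A}
    (hy : ∀ g, y.coeff g ≠ 0 → 0 < (v g).toAdd) (x : NovikovModule v) :
    ∃ z : NovikovModule v, (1 - y) • z = x := by
  classical
  obtain ⟨ε, hε, hyε⟩ : ∃ ε : ℝ, 0 < ε ∧ ∀ g, y.coeff g ≠ 0 → ε ≤ (v g).toAdd := by
    by_cases hne : y.coeff.support.Nonempty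
    · obtain ⟨g, hg, hmin⟩ := Finset.exists_min_image _ (fun g => (v g).toAdd) hne
      exact ⟨_, hy g (by simpa using hg), fun h hh => hmin h (by simpa using hh)⟩
    · refine ⟨1, one_pos, fun g hg => absurd ⟨g, by simpa using hg⟩ hne⟩
  obtain ⟨b, hb⟩ : ∃ b : ℝ, ∀ g, novCoeff x g ≠ 0 → b ≤ (v g).toAdd := by
    by_cases hne : {g : A | novCoeff x g ≠ 0 ∧ (v g).toAdd ≤ 0}.Nonempty
    · obtain ⟨g, hg, hmin⟩ := Set.exists_min_image _ (fun g => (v g).toAdd)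
        (finite_novCoeff x 0) hne
      refine ⟨(v g).toAdd, fun h hh => ?_⟩
      by_cases hle : (v h).toAdd ≤ 0
      · exact hmin h ⟨hh, hle⟩
      · exact hg.2.trans (not_le.1 hle).le
    · exact ⟨0, fun g hg => (not_le.1 fun h => hne ⟨g, hg, h⟩).le⟩
  have hpow (n : ℕ) : ∀ g, novCoeff (y ^ n • x) g ≠ 0 → n * ε + b ≤ (v g).toAdd := by
    induction n with
    | zero => intro g hg; simpa using hb g (by simpa using hg)
    | succ n ih =>
      intro g hg
      rw [pow_succ', mul_smul] at hg
      obtain ⟨c, d, hc, hd, rfl⟩ := exists_of_novCoeff_smul_ne_zero hg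
      have h1 := hyε c hc
      have h2 := ih d hd
      simp only [map_mul, toAdd_mul]
      push_cast
      linarith
  -- the terms of the geometric series which contribute where `v` is at most `C`
  let N : ℝ → ℕ := fun C => ⌈(C - b) / ε⌉₊ + 1
  have hN (C : ℝ) (n : ℕ) (hn : N C ≤ n) : C < n * ε + b := by
    have h1 : (C - b) / ε < n := by
      refine (Nat.le_ceil _).trans_lt ?_
      exact_mod_cast hn
    rw [div_lt_iff₀ hε] at h1
    linarith
  let S : ℕ → NovikovModule v := fun m => (∑ n ∈ Finset.range m, y ^ n) • x
  have hS (m n : ℕ) (g : A) (hm : N (v g).toAdd ≤ m) (hn : m ≤ n) :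
      novCoeff (S n) g = novCoeff (S m) g := by
    induction n, hn using Nat.le_induction with
    | base => rfl
    | succ n hmn ih =>
      have h0 : novCoeff (y ^ n • x) g = 0 := by
        by_contra hne
        exact absurd (hpow n g hne) (not_le.2 (hN _ n (hm.trans hmn)))
      rw [← ih]
      simp only [S, Finset.sum_range_succ, add_smul, map_add, Pi.add_apply, h0, add_zero]
  have hmono {C D : ℝ} (h : C ≤ D) : N C ≤ N D := by
    refine Nat.succ_le_succ (Nat.ceil_mono ?_)
    gcongr
  let z : NovikovModule v := novMk (fun g => novCoeff (S (N (v g).toAdd)) g) fun C => by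
    refine (finite_novCoeff (S (N C)) C).subset fun g hg => ⟨?_, hg.2⟩
    rw [hS _ (N C) g le_rfl (hmono hg.2)]
    exact hg.1
  have hz (m : ℕ) (g : A) (hm : N (v g).toAdd ≤ m) : novCoeff z g = novCoeff (S m) g :=
    (hS _ m g le_rfl hm).symm
  refine ⟨z, novCoeff_injective (funext fun g => ?_)⟩
  let m := N (v g).toAdd
  -- All terms of y are positive, so only coefficients of z strictly below g enter, and there the
  -- partial sum S m is already stable.
  have h1 : novCoeff (y • z) g = novCoeff (y • S m) g := by
    rw [novCoeff_smul, novCoeff_smul]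
    refine Finset.sum_congr rfl fun c hc => ?_
    rw [hz m]
    refine hmono ?_
    have := hy c (by simpa using hc)
    simp only [map_mul, map_inv, toAdd_mul, toAdd_inv]
    linarith
  have h2 : S m - y • S m = x - y ^ m • x := by
    have := mul_neg_geom_sum y m
    simp only [S]
    rw [← mul_smul]
    nth_rewrite 1 [← one_smul (MonoidAlgebra ℤ A) ((∑ n ∈ Finset.range m, y ^ n) • x)]
    rw [← mul_smul, ← sub_smul, ← sub_mul, this, sub_smul, one_smul]
  have h3 : novCoeff (y ^ m • x) g = 0 := by
    by_contra hne
    exact absurd (hpow m g hne) (not_le.2 (hN _ m le_rfl))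
  have h4 := congrArg (fun t => novCoeff t g) h2
  simp only [map_sub, Pi.sub_apply, h3, sub_zero] at h4
  rw [sub_smul, one_smul, map_sub, Pi.sub_apply, h1, hz m g le_rfl, h4]

/-- Monic elements act bijectively on the Novikov completion. -/
lemma bijective_smul_of_isMonic {s : MonoidAlgebra ℤ A}
    (hs : IsMonic v s) : Function.Bijective fun x : NovikovModule v => s • x := by
  classical
  refine ⟨fun x x' h => sub_eq_zero.1 (smul_eq_zero_of_isMonic hs ?_), fun x => ?_⟩
  · rw [smul_sub]
    exact sub_eq_zero.2 h
  obtain ⟨a, ha, hau⟩ := isMonic_iff.1 hs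
  let c := s.coeff a
  -- Dividing s by its initial term c·a leaves 1 minus an element with all terms positive, which a
  -- geometric series inverts.
  have hcc : c * c = 1 := Int.isUnit_mul_self hau
  let t : MonoidAlgebra ℤ A := MonoidAlgebra.single a⁻¹ c
  have hts (g : A) : (t * s).coeff g = c * s.coeff (a * g) := by
    rw [MonoidAlgebra.coeff_single_mul_apply, inv_inv]
  obtain ⟨z, hz⟩ := exists_one_sub_smul_eq (v := v) (y := 1 - t * s) (fun g hg => by
    rw [MonoidAlgebra.coeff_sub, Finsupp.sub_apply, hts, MonoidAlgebra.one_def,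
      MonoidAlgebra.coeff_single, Finsupp.single_apply] at hg
    split_ifs at hg with e
    · subst e
      rw [mul_one] at hg
      exact (hg (by rw [hcc, sub_self])).elim
    · have := ha.2 (a * g) (fun h => e (mul_eq_left.1 h).symm)
        (fun h => hg (by rw [h, mul_zero, sub_zero]))
      simpa using this) (t • x)
  refine ⟨z, ?_⟩
  rw [sub_sub_cancel, mul_smul] at hz
  have hinv : MonoidAlgebra.single a c * t = 1 := by
    rw [MonoidAlgebra.single_mul_single, hcc, mul_inv_cancel, MonoidAlgebra.one_def]
  have := congrArg (fun w => MonoidAlgebra.single a c • w) hz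
  simpa only [← mul_smul, ← mul_assoc, hinv, one_mul, one_smul] using this

end NovikovModule

/-! ### Homology with coefficients in modules over `ℤ[G / ker u]` -/

section TwistedChains

variable {G : Type} [Group G] (H : Subgroup G) (u : G →* Multiplicative ℝ)

/-- The `G`-module `E^(G/H)`, for a module `E` over `ℤ[G / ker u]`, with `G` acting both on `E`
and on the index set. -/
def twistedRep (E : Type) [AddCommGroup E] [Module (QuotientRing u) E] :
    Representation (QuotientRing u) G (G ⧸ H → E) where
  toFun g :=
    { toFun := fun f x => MonoidAlgebra.single (g : G ⧸ u.ker) (1 : ℤ) • f (g⁻¹ • x)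
      map_add' := fun f f' => by
        funext x
        simp [smul_add]
      map_smul' := fun r f => by
        funext x
        simp only [Pi.smul_apply, RingHom.id_apply]
        exact smul_comm _ _ _ }
  map_one' := by
    refine LinearMap.ext fun f => funext fun x => ?_
    simp [← MonoidAlgebra.one_def]
  map_mul' g h := by
    refine LinearMap.ext fun f => funext fun x => ?_
    simp [← mul_smul, MonoidAlgebra.single_mul_single]

lemma alexanderRep_eq : alexanderRep H u = twistedRep H u (QuotientRing u) := rfl

variable {H u} {E E' : Type} [AddCommGroup E] [Module (QuotientRing u) E] [AddCommGroup E']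
  [Module (QuotientRing u) E']

lemma twistedRep_apply (g : G) (f : G ⧸ H → E) (x : G ⧸ H) :
    twistedRep H u E g f x = MonoidAlgebra.single (g : G ⧸ u.ker) (1 : ℤ) • f (g⁻¹ • x) := rfl

variable (H) in
/-- The map on chains induced by a linear map of coefficients. -/
def chainMap (X : Type) (φ : E →ₗ[QuotientRing u] E') :
    (X →₀ (G ⧸ H → E)) →ₗ[QuotientRing u] (X →₀ (G ⧸ H → E')) :=
  Finsupp.mapRange.linearMap (φ.compLeft (G ⧸ H))

@[simp] lemma chainMap_single {X : Type} (φ : E →ₗ[QuotientRing u] E') (a : X) (f : G ⧸ H → E) :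
    chainMap H X φ (Finsupp.single a f) = Finsupp.single a (φ.compLeft (G ⧸ H) f) := by
  simp [chainMap]

lemma chainMap_apply {X : Type} (φ : E →ₗ[QuotientRing u] E') (z : X →₀ (G ⧸ H → E)) (a : X)
    (x : G ⧸ H) : chainMap H X φ z a x = φ (z a x) := rfl

lemma compLeft_twistedRep (φ : E →ₗ[QuotientRing u] E') (g : G) (f : G ⧸ H → E) :
    φ.compLeft (G ⧸ H) (twistedRep H u E g f) = twistedRep H u E' g (φ.compLeft (G ⧸ H) f) := by
  funext x
  simp [twistedRep_apply]

lemma diffOne_chainMap (φ : E →ₗ[QuotientRing u] E') (z : G →₀ (G ⧸ H → E)) :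
    diffOne (twistedRep H u E') (chainMap H G φ z) =
      φ.compLeft (G ⧸ H) (diffOne (twistedRep H u E) z) :=
  diffOne_mapRange (twistedRep H u E) (twistedRep H u E') (φ.compLeft (G ⧸ H)).toAddMonoidHom
    (compLeft_twistedRep φ) z

lemma diffTwo_chainMap (φ : E →ₗ[QuotientRing u] E') (w : G × G →₀ (G ⧸ H → E)) :
    diffTwo (twistedRep H u E') (chainMap H (G × G) φ w) =
      chainMap H G φ (diffTwo (twistedRep H u E) w) :=
  diffTwo_mapRange (twistedRep H u E) (twistedRep H u E') (φ.compLeft (G ⧸ H)).toAddMonoidHom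
    (compLeft_twistedRep φ) w

/-! #### A retraction onto the cycles, up to a monic factor -/

variable (H u) in
/-- The element `γ ^ n - 1` of the group ring, where `n` is the index of `H`. -/
def shiftSubOne (γ : G) : QuotientRing u :=
  MonoidAlgebra.single ((γ ^ H.index : G) : G ⧸ u.ker) 1 - 1

variable (H u E) in
/-- The operator `1 + γ + ⋯ + γ ^ (n - 1)`, where `n` is the index of `H`. -/
def normMap (γ : G) : (G ⧸ H → E) →ₗ[QuotientRing u] (G ⧸ H → E) :=
  ∑ i ∈ Finset.range H.index, twistedRep H u E γ ^ i

variable (H u E) in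
/-- A map from chains to cycles which restricts to a scalar on cycles. -/
def cycleMap (γ : G) : (G →₀ (G ⧸ H → E)) →ₗ[QuotientRing u] (G →₀ (G ⧸ H → E)) :=
  shiftSubOne H u γ • LinearMap.id -
    Finsupp.lsingle γ⁻¹ ∘ₗ normMap H u E γ ∘ₗ diffOne (twistedRep H u E)

lemma cycleMap_apply (γ : G) (z : G →₀ (G ⧸ H → E)) :
    cycleMap H u E γ z = shiftSubOne H u γ • z -
      Finsupp.single γ⁻¹ (normMap H u E γ (diffOne (twistedRep H u E) z)) := rfl

lemma cycleMap_of_diffOne_eq_zero (γ : G) {z : G →₀ (G ⧸ H → E)}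
    (hz : diffOne (twistedRep H u E) z = 0) : cycleMap H u E γ z = shiftSubOne H u γ • z := by
  rw [cycleMap_apply, hz]
  simp

lemma normMap_comp (φ : E →ₗ[QuotientRing u] E') (γ : G) (f : G ⧸ H → E) :
    φ.compLeft (G ⧸ H) (normMap H u E γ f) = normMap H u E' γ (φ.compLeft (G ⧸ H) f) := by
  simp only [normMap, LinearMap.sum_apply, map_sum]
  refine Finset.sum_congr rfl fun i _ => ?_
  rw [← map_pow, ← map_pow]
  exact compLeft_twistedRep φ _ f

lemma cycleMap_chainMap (φ : E →ₗ[QuotientRing u] E') (γ : G) (z : G →₀ (G ⧸ H → E)) :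
    cycleMap H u E' γ (chainMap H G φ z) = chainMap H G φ (cycleMap H u E γ z) := by
  rw [cycleMap_apply, cycleMap_apply, map_sub, map_smul, diffOne_chainMap, chainMap_single,
    normMap_comp]

/-- The homology of `E^(G/H)` vanishes if it is killed by a scalar acting bijectively on `E`. -/
lemma mem_range_of_bijective {s : QuotientRing u}
    (hs : Function.Bijective fun x : E => s • x)
    {z : G →₀ (G ⧸ H → E)} (hz : s • z ∈ LinearMap.range (diffTwo (twistedRep H u E))) :
    z ∈ LinearMap.range (diffTwo (twistedRep H u E)) := by
  -- Division by s is linear over the group ring, hence commutes with the differentials, and can be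
  -- applied to the bounding chain.
  let τ : E ≃ₗ[QuotientRing u] E := LinearEquiv.ofBijective (LinearMap.lsmul _ E s) hs
  obtain ⟨w, hw⟩ := hz
  refine ⟨chainMap H (G × G) τ.symm.toLinearMap w, ?_⟩
  rw [diffTwo_chainMap, hw]
  refine Finsupp.ext fun a => funext fun x => ?_
  rw [chainMap_apply]
  exact τ.symm_apply_apply (z a x)

variable [H.Normal]

/-- By normality γ ^ [G : H] lies in H and acts trivially on G/H, so only its scalar action on E
remains. -/
lemma twistedRep_pow_index (γ : G) (f : G ⧸ H → E) :
    twistedRep H u E (γ ^ H.index) f =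
      MonoidAlgebra.single ((γ ^ H.index : G) : G ⧸ u.ker) (1 : ℤ) • f := by
  funext x
  rw [twistedRep_apply, Pi.smul_apply]
  congr 2
  induction x using QuotientGroup.induction_on with
  | H x =>
    change (((γ ^ H.index)⁻¹ * x : G) : G ⧸ H) = x
    rw [QuotientGroup.mk_mul, QuotientGroup.mk_inv,
      (QuotientGroup.eq_one_iff _).2 (H.pow_index_mem γ), inv_one, one_mul]

lemma twistedRep_normMap (γ : G) (f : G ⧸ H → E) :
    twistedRep H u E γ (normMap H u E γ f) - normMap H u E γ f = shiftSubOne H u γ • f := by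
  have h := mul_geom_sum (twistedRep H u E γ) H.index
  have h2 := LinearMap.congr_fun h f
  rw [← map_pow, LinearMap.sub_apply, twistedRep_pow_index] at h2
  rw [shiftSubOne, sub_smul, one_smul]
  exact h2

/-- The differential at γ⁻¹ is γ - 1, and (γ - 1)(1 + γ + ⋯ + γ ^ (n - 1)) = γ ^ n - 1 is the scalar
`shiftSubOne`; the two contributions cancel. -/
lemma diffOne_cycleMap (γ : G) (z : G →₀ (G ⧸ H → E)) :
    diffOne (twistedRep H u E) (cycleMap H u E γ z) = 0 := by
  rw [cycleMap_apply, map_sub, map_smul, diffOne_single, inv_inv, twistedRep_normMap, sub_self]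

variable [H.FiniteIndex]

/-- A scalar killing the homology of `ℤ[G / ker u]^(G/H)` kills, up to a fixed factor, the homology
of `E^(G/H)` for every module `E`. -/
lemma smul_mem_range_of_forall (γ : G) {s : QuotientRing u}
    (hs : ∀ z, diffOne (twistedRep H u (QuotientRing u)) z = 0 →
      s • z ∈ LinearMap.range (diffTwo (twistedRep H u (QuotientRing u))))
    {z : G →₀ (G ⧸ H → E)} (hz : diffOne (twistedRep H u E) z = 0) :
    (s * shiftSubOne H u γ) • z ∈ LinearMap.range (diffTwo (twistedRep H u E)) := by
  classical
  have : Finite (G ⧸ H) := inferInstance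
  have := Fintype.ofFinite (G ⧸ H)
  -- This form holds for all chains, not just cycles, so it can be checked on elementary chains,
  -- which come from the group ring along maps 1 ↦ f j.
  suffices ∀ z, s • cycleMap H u E γ z ∈ LinearMap.range (diffTwo (twistedRep H u E)) by
    rw [mul_smul, ← cycleMap_of_diffOne_eq_zero γ hz]
    exact this z
  intro z
  induction z using Finsupp.induction_linear with
  | zero => simp
  | add a b ha hb => rw [map_add, smul_add]; exact add_mem ha hb
  | single g f =>
    have hf : f = ∑ j, (LinearMap.toSpanSingleton (QuotientRing u) E (f j)).compLeft (G ⧸ H)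
        (Pi.single j 1) := by
      funext x
      rw [Finset.sum_apply, Finset.sum_eq_single x]
      · simp
      · intro j _ hj
        simp [hj.symm]
      · simp
    have hsing : Finsupp.single g f = ∑ j, chainMap H G
        (LinearMap.toSpanSingleton (QuotientRing u) E (f j))
        (Finsupp.single g (Pi.single j 1)) := by
      conv_lhs => rw [hf]
      simp only [chainMap_single]
      exact map_sum (Finsupp.singleAddHom g) _ _
    rw [hsing, map_sum, Finset.smul_sum]
    refine Submodule.sum_mem _ fun j _ => ?_
    obtain ⟨w, hw⟩ := hs _ (diffOne_cycleMap (u := u) (E := QuotientRing u) γ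
      (Finsupp.single g (Pi.single j 1)))
    rw [cycleMap_chainMap, ← map_smul, ← hw, ← diffTwo_chainMap]
    exact ⟨_, rfl⟩

end TwistedChains

/-! #### Approximating Novikov boundaries -/

section Approximation

/-- The determinant trick: multiply the relations by the adjugate of X. -/
lemma det_smul_eq_zero {R M ι : Type*} [CommRing R] [AddCommGroup M] [Module R M] [Fintype ι]
    [DecidableEq ι] (X : Matrix ι ι R) (m : ι → M) (h : ∀ i, ∑ j, X i j • m j = 0) (i : ι) :
    X.det • m i = 0 := by
  have : ∑ k, X.adjugate i k • ∑ j, X k j • m j = ∑ j, (X.adjugate * X) i j • m j := by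
    simp only [Finset.smul_sum, smul_smul, Matrix.mul_apply, Finset.sum_smul]
    exact Finset.sum_comm
  rw [Matrix.adjugate_mul] at this
  simpa [h, Matrix.one_apply] using this.symm

variable {G : Type} [Group G] {H : Subgroup G} [H.FiniteIndex]
  {u : G →* Multiplicative ℝ}

variable (H) in
lemma exists_shiftSubOne_eq {γ : G} (hγ : 0 < (u γ).toAdd) :
    ∃ t : nonnegSubring (QuotientGroup.kerLift u), t.1 = shiftSubOne H u γ ∧
      constCoeff (QuotientGroup.kerLift_injective u) t = -1 := by
  classical
  let τ : G ⧸ u.ker := (γ ^ H.index : G)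
  have hτ : 0 < (QuotientGroup.kerLift u τ).toAdd := by
    rw [QuotientGroup.kerLift_mk, map_pow, toAdd_pow, nsmul_eq_mul]
    exact mul_pos (by exact_mod_cast Nat.pos_of_ne_zero Subgroup.FiniteIndex.index_ne_zero) hγ
  have hsingle : MonoidAlgebra.single τ (1 : ℤ) ∈ nonnegSubring (QuotientGroup.kerLift u) := by
    intro g hg
    rw [MonoidAlgebra.coeff_single, Finsupp.single_apply] at hg
    split_ifs at hg with e
    · rw [← e]; exact hτ.le
    · exact absurd rfl hg
  refine ⟨⟨MonoidAlgebra.single τ 1, hsingle⟩ - 1, rfl, ?_⟩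
  rw [map_sub, map_one, constCoeff_apply, MonoidAlgebra.coeff_single, Finsupp.single_apply,
    if_neg, zero_sub]
  intro h
  rw [h] at hτ
  simp at hτ

variable (H) in
lemma isMonic_shiftSubOne {γ : G} (hγ : 0 < (u γ).toAdd) :
    IsMonic (QuotientGroup.kerLift u) (shiftSubOne H u γ) := by
  obtain ⟨t, ht, hc⟩ := exists_shiftSubOne_eq H hγ
  rw [← ht]
  exact isMonic_of_isUnit_constCoeff (QuotientGroup.kerLift_injective u) t
    (by rw [hc]; exact isUnit_one.neg)

/-- A cycle over `ℤ[G / ker u]` which is a boundary over the Novikov completion is homologous to a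
combination of given generators with coefficients of positive order. -/
lemma exists_positive_combination {N : ℕ}
    (q : Fin N → (G →₀ (G ⧸ H → QuotientRing u)) ⧸
      LinearMap.range (diffTwo (twistedRep H u (QuotientRing u))))
    (hq : Submodule.span (QuotientRing u) (Set.range q) = ⊤)
    (z : G →₀ (G ⧸ H → QuotientRing u))
    (hz : chainMap H G (toNovikov (QuotientGroup.kerLift u)) z ∈
      LinearMap.range (diffTwo (twistedRep H u (NovikovModule (QuotientGroup.kerLift u))))) :
    ∃ (w : G × G →₀ (G ⧸ H → QuotientRing u)) (a : Fin N → QuotientRing u),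
      (∀ i g, (a i).coeff g ≠ 0 → 0 < (QuotientGroup.kerLift u g).toAdd) ∧
      Submodule.Quotient.mk (z - diffTwo (twistedRep H u (QuotientRing u)) w) =
        ∑ i, a i • q i := by
  classical
  have := Fintype.ofFinite (G ⧸ H)
  let v := QuotientGroup.kerLift u
  let R := QuotientRing u
  let ι : R →ₗ[R] NovikovModule v := toNovikov v
  obtain ⟨ŵ, hŵ⟩ := hz
  -- The truncation errors for all C together form one chain with coefficients in a module over the
  -- group ring. Its boundary ω thus has a finite support independent of C and coefficients tending
  -- to zero.
  let tail : NovikovModule v → nullFamilies v :=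
    fun x => ⟨fun C => x - ι (truncate C x), sub_truncate_mem_nullFamilies x⟩
  have htail : tail 0 = 0 := Subtype.ext (funext fun C => by
    change 0 - ι (truncate C 0) = 0
    rw [truncate_zero, map_zero, sub_zero])
  let trunc (C : ℝ) : G × G →₀ (G ⧸ H → R) :=
    ŵ.mapRange (fun f x => truncate C (f x)) (funext fun x => truncate_zero C)
  let w' : G × G →₀ (G ⧸ H → nullFamilies v) :=
    ŵ.mapRange (fun f x => tail (f x)) (funext fun x => htail)
  let ev (C : ℝ) : nullFamilies v →ₗ[R] NovikovModule v :=
    LinearMap.proj C ∘ₗ (nullFamilies v).subtype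
  have hsplit (C : ℝ) : chainMap H (G × G) (ev C) w' = ŵ - chainMap H (G × G) ι (trunc C) :=
    Finsupp.ext fun _ => funext fun _ => rfl
  let ω := diffTwo (twistedRep H u (nullFamilies v)) w'
  let ζ (C : ℝ) := z - diffTwo (twistedRep H u R) (trunc C)
  have hζ (C : ℝ) : chainMap H G ι (ζ C) = chainMap H G (ev C) ω := by
    rw [map_sub, ← diffTwo_chainMap, ← diffTwo_chainMap, hsplit, map_sub, hŵ]
  have hζ' (C : ℝ) (g : G) (x : G ⧸ H) : ι (ζ C g x) = (ω g x).1 C :=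
    congrFun (DFunLike.congr_fun (hζ C) g) x
  have hsupp (C : ℝ) : (ζ C).support ⊆ ω.support := by
    intro g hg
    rw [Finsupp.mem_support_iff] at hg ⊢
    refine fun h0 => hg (funext fun x => toNovikov_injective (v := v) ?_)
    refine (hζ' C g x).trans ?_
    rw [h0]
    exact (map_zero ι).symm
  have hb (g : G) (x : G ⧸ H) : ∃ b : Fin N → R, ∑ i, b i • q i =
      Submodule.Quotient.mk (Finsupp.single g (Pi.single x 1)) := by
    refine (Submodule.mem_span_range_iff_exists_fun R).1 ?_
    rw [hq]
    trivial
  choose b hb using hb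
  let a (C : ℝ) (i : Fin N) : R := ∑ g ∈ ω.support, ∑ x, b g x i * ζ C g x
  have hnull (i : Fin N) : (fun C => ι (a C i)) ∈ nullFamilies v := by
    have : (fun C => ι (a C i)) = ∑ g ∈ ω.support, ∑ x, b g x i • (ω g x).1 := by
      funext C
      simp only [a, map_sum, Finset.sum_apply, Pi.smul_apply]
      refine Finset.sum_congr rfl fun g _ => Finset.sum_congr rfl fun x _ => ?_
      rw [← smul_eq_mul, map_smul, hζ']
    rw [this]
    exact Submodule.sum_mem _ fun g _ => Submodule.sum_mem _ fun x _ =>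
      Submodule.smul_mem _ _ (ω g x).2
  have hev : ∀ᶠ C in Filter.atTop, ∀ i, ∀ g, novCoeff (ι (a C i)) g ≠ 0 →
      1 ≤ (v g).toAdd := Filter.eventually_all.2 fun i => hnull i 1
  obtain ⟨C, hC⟩ := hev.exists
  refine ⟨trunc C, a C, fun i g hg => ?_, ?_⟩
  · refine one_pos.trans_le (hC i g ?_)
    rwa [novCoeff_toNovikov]
  · have hsum : ζ C = ∑ g ∈ ω.support, ∑ x, ζ C g x • Finsupp.single g (Pi.single x (1 : R)) := by
      conv_lhs => rw [← Finsupp.sum_single (ζ C)]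
      rw [Finsupp.sum_of_support_subset _ (hsupp C) _ (by simp)]
      refine Finset.sum_congr rfl fun g _ => ?_
      have : ζ C g = ∑ x, ζ C g x • Pi.single x (1 : R) := by
        funext y
        simp [Finset.sum_apply, Pi.single_apply]
      conv_lhs => rw [this]
      simp only [Finsupp.smul_single]
      exact map_sum (Finsupp.singleAddHom g) _ _
    change Submodule.Quotient.mk (ζ C) = _
    conv_lhs => rw [hsum]
    rw [← Submodule.mkQ_apply]
    simp only [map_sum, map_smul, a, Finset.sum_smul]
    symm
    refine Finset.sum_comm.trans ?_
    refine Finset.sum_congr rfl fun g _ => ?_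
    refine Finset.sum_comm.trans ?_
    refine Finset.sum_congr rfl fun x _ => ?_
    rw [Submodule.mkQ_apply, ← hb, Finset.smul_sum]
    refine Finset.sum_congr rfl fun i _ => ?_
    rw [smul_smul, mul_comm]

variable [H.Normal]

/-- If all the cycles in the image of `cycleMap` become boundaries over the Novikov completion,
then a monic element kills the homology of `ℤ[G / ker u]^(G/H)`. -/
theorem exists_isMonic_smul_mem_range [Group.FG G] {γ : G} (hγ : 0 < (u γ).toAdd)
    (h : ∀ z, chainMap H G (toNovikov (QuotientGroup.kerLift u))
      (cycleMap H u (QuotientRing u) γ z) ∈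
        LinearMap.range (diffTwo (twistedRep H u (NovikovModule (QuotientGroup.kerLift u))))) :
    ∃ s, IsMonic (QuotientGroup.kerLift u) s ∧
      ∀ z, diffOne (twistedRep H u (QuotientRing u)) z = 0 →
        s • z ∈ LinearMap.range (diffTwo (twistedRep H u (QuotientRing u))) := by
  classical
  let R := QuotientRing u
  have hv := QuotientGroup.kerLift_injective u
  let D := LinearMap.range (diffTwo (twistedRep H u R))
  obtain ⟨N, q, hq⟩ := Submodule.fg_iff_exists_fin_generating_family.1
    (fg_top_chains_quotient_boundaries (twistedRep H u R))
  choose c hc using fun i => D.mkQ_surjective (q i)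
  let r := cycleMap H u R γ
  have hrD : D ≤ D.comap r := by
    rintro _ ⟨w, rfl⟩
    rw [Submodule.mem_comap, cycleMap_of_diffOne_eq_zero γ (diffOne_diffTwo _ w)]
    exact D.smul_mem _ ⟨w, rfl⟩
  let r' := D.mapQ D r hrD
  choose w a ha hwa using fun i => exists_positive_combination q hq (r (c i)) (h (c i))
  let m : Fin N → (G →₀ (G ⧸ H → R)) ⧸ D := fun i => r' (q i)
  have hm (i : Fin N) : m i = D.mkQ (r (c i)) := by
    simp only [m, ← hc]
    rfl
  -- Applying r a second time multiplies the cycle by the scalar, while its expansion in the q j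
  -- turns into one in the m j.
  have hrel (i : Fin N) : shiftSubOne H u γ • m i = ∑ j, a i j • m j := by
    have h1 : D.mkQ (r (c i) - diffTwo (twistedRep H u R) (w i)) = m i := by
      rw [map_sub, hm, sub_eq_self]
      exact (Submodule.Quotient.mk_eq_zero D).2 ⟨_, rfl⟩
    have h2 : r (r (c i) - diffTwo (twistedRep H u R) (w i)) =
        shiftSubOne H u γ • (r (c i) - diffTwo (twistedRep H u R) (w i)) :=
      cycleMap_of_diffOne_eq_zero γ (by
        rw [map_sub, diffOne_diffTwo, sub_zero]
        exact diffOne_cycleMap γ (c i))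
    calc shiftSubOne H u γ • m i
        = D.mkQ (r (r (c i) - diffTwo (twistedRep H u R) (w i))) := by rw [h2, map_smul, h1]
      _ = r' (D.mkQ (r (c i) - diffTwo (twistedRep H u R) (w i))) := rfl
      _ = r' (∑ j, a i j • q j) := congrArg r' (hwa i)
      _ = ∑ j, a i j • m j := by simp only [map_sum, map_smul, m]
  obtain ⟨t, ht, htc⟩ := exists_shiftSubOne_eq H hγ
  let a' : Matrix (Fin N) (Fin N) (nonnegSubring (QuotientGroup.kerLift u)) :=
    Matrix.of fun i j => ⟨a i j, fun g hg => (ha i j g hg).le⟩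
  have ha' (i j : Fin N) : constCoeff hv (a' i j) = 0 := by
    by_contra h0
    have := ha i j 1 h0
    simp at this
  let X' := t • (1 : Matrix (Fin N) (Fin N) _) - a'
  let X : Matrix (Fin N) (Fin N) R :=
    shiftSubOne H u γ • (1 : Matrix (Fin N) (Fin N) R) - Matrix.of a
  have hX : X = (nonnegSubring (QuotientGroup.kerLift u)).subtype.mapMatrix X' := by
    ext1 i j
    by_cases e : i = j
    · subst e
      simp [X, X', ht, a', Matrix.sub_apply]
    · simp [X, X', e, a', Matrix.sub_apply]
  -- Taking constant coefficients kills the positive entries a i j and sends the scalar to -1, so X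
  -- becomes -1 and its determinant ±1.
  have hdet : IsMonic (QuotientGroup.kerLift u) X.det := by
    rw [hX, ← RingHom.map_det]
    refine isMonic_of_isUnit_constCoeff hv _ ?_
    have : (constCoeff hv).mapMatrix X' = -1 := by
      ext i j
      by_cases e : i = j
      · subst e
        simp [X', ha', htc, Matrix.sub_apply]
      · simp [X', ha', e, Matrix.sub_apply]
    rw [RingHom.map_det, this, Matrix.det_neg, Matrix.det_one, mul_one]
    exact isUnit_one.neg.pow _
  have hXm (i : Fin N) : ∑ j, X i j • m j = 0 := by
    simp only [X, Matrix.sub_apply, Matrix.smul_apply, Matrix.one_apply, sub_smul,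
      Finset.sum_sub_distrib]
    simpa using sub_eq_zero.2 (hrel i)
  have hkill := det_smul_eq_zero X m hXm
  refine ⟨X.det * shiftSubOne H u γ, (isMonic_mul_iff hv).2 ⟨hdet, isMonic_shiftSubOne H hγ⟩,
    fun z hz => ?_⟩
  obtain ⟨b, hb⟩ := (Submodule.mem_span_range_iff_exists_fun R).1
    (show D.mkQ z ∈ Submodule.span R (Set.range q) by rw [hq]; trivial)
  have h1 : D.mkQ (shiftSubOne H u γ • z) = ∑ i, b i • m i := by
    rw [← cycleMap_of_diffOne_eq_zero γ hz]
    change r' (D.mkQ z) = _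
    rw [← hb]
    simp only [map_sum, map_smul, m]
  refine (Submodule.Quotient.mk_eq_zero D).1 ?_
  rw [← Submodule.mkQ_apply, mul_smul, map_smul, h1, Finset.smul_sum]
  refine Finset.sum_eq_zero fun i _ => ?_
  rw [smul_comm, hkill, smul_zero]

end Approximation

/-! ### Comparison of the two Novikov coefficient modules -/

section Comparison

variable {G : Type} [Group G] (H : Subgroup G) (u : G →* Multiplicative ℝ)

/-- The completed module with coefficients in `ℤ[G / ker u]^(G/H)`. -/
abbrev CompletedModule : Type := G ⧸ H → NovikovModule (QuotientGroup.kerLift u)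

/-- The completed twisted representation. -/
abbrev completedRep : Representation (QuotientRing u) G (CompletedModule H u) :=
  twistedRep H u (NovikovModule (QuotientGroup.kerLift u))

lemma novCoeff_completedRep (g : G) (f : CompletedModule H u) (x : G ⧸ H) (a : G ⧸ u.ker) :
    novCoeff (completedRep H u g f x) a = novCoeff (f (g⁻¹ • x)) ((g : G ⧸ u.ker)⁻¹ * a) := by
  rw [twistedRep_apply, novCoeff_single_smul, one_mul]

variable [H.Normal]

/-- The orbit map of `(1, j)` for the action of `G / (H ∩ ker u)` on `G / ker u × G / H`. -/
def orbitMap (j : G ⧸ H) (γ : G ⧸ (H ⊓ u.ker)) : (G ⧸ u.ker) × (G ⧸ H) :=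
  (QuotientGroup.map (H ⊓ u.ker) u.ker (MonoidHom.id G) inf_le_right γ,
    QuotientGroup.map (H ⊓ u.ker) H (MonoidHom.id G) inf_le_left γ * j)

/-- Freeness of the action: the stabilizer of (1, j) in G is H ∩ ker u, as H is normal. -/
lemma orbitMap_injective (j : G ⧸ H) : Function.Injective (orbitMap H u j) := by
  intro a b
  induction a using QuotientGroup.induction_on with
  | H a =>
    induction b using QuotientGroup.induction_on with
    | H b =>
      intro h
      have h1 : (a : G ⧸ u.ker) = b := congrArg Prod.fst h
      have h2 : (a : G ⧸ H) = b := mul_right_cancel (congrArg Prod.snd h)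
      rw [QuotientGroup.eq] at h1 h2 ⊢
      exact ⟨h2, h1⟩

lemma orbitMap_mk_mul (j : G ⧸ H) (g : G) (γ : G ⧸ (H ⊓ u.ker)) :
    orbitMap H u j ((g : G ⧸ (H ⊓ u.ker)) * γ) =
      ((g : G ⧸ u.ker) * (orbitMap H u j γ).1, g • (orbitMap H u j γ).2) := by
  refine Prod.ext (map_mul _ _ _) ?_
  induction γ using QuotientGroup.induction_on with
  | H b =>
    induction j using QuotientGroup.induction_on with
    | H c =>
      change (((g * b) * c : G) : G ⧸ H) = ((g * (b * c) : G) : G ⧸ H)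
      rw [mul_assoc]

lemma kerLift_orbitMap (j : G ⧸ H) (γ : G ⧸ (H ⊓ u.ker)) :
    QuotientGroup.kerLift u (orbitMap H u j γ).1 = inducedHom H u γ := by
  induction γ using QuotientGroup.induction_on with
  | H b => rfl

/-- The representation of `G` on the Novikov completion of `ℤ[G / (H ∩ ker u)]`. -/
abbrev relativeNovikovRep : Representation ℤ G (novikov (inducedHom H u)) :=
  (novikovRep (inducedHom H u)).comp (QuotientGroup.mk' (H ⊓ u.ker))

lemma relativeNovikovRep_apply (g : G) (x : novikov (inducedHom H u)) (γ : G ⧸ (H ⊓ u.ker)) :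
    (relativeNovikovRep H u g x).1 γ = x.1 ((g : G ⧸ (H ⊓ u.ker))⁻¹ * γ) := rfl

/-- Extension by zero along an orbit. -/
def extendOrbit (j : G ⧸ H) : novikov (inducedHom H u) →+ CompletedModule H u where
  toFun x := fun y => novMk (fun a => Function.extend (orbitMap H u j) x.1 0 (a, y)) fun C => by
    refine ((x.2 C).image fun γ => (orbitMap H u j γ).1).subset ?_
    rintro a ⟨ha, hC⟩
    by_cases h : ∃ γ, orbitMap H u j γ = (a, y)
    · obtain ⟨γ, hγ⟩ := h
      rw [← hγ, (orbitMap_injective H u j).extend_apply] at ha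
      refine ⟨γ, ⟨ha, ?_⟩, by simp [hγ]⟩
      rw [← kerLift_orbitMap H u j, hγ]
      exact hC
    · exact absurd (Function.extend_apply' _ _ _ h) ha
  map_zero' := by
    refine funext fun y => novCoeff_injective (funext fun a => ?_)
    rw [novCoeff_novMk]
    by_cases h : ∃ γ, orbitMap H u j γ = (a, y)
    · obtain ⟨γ, hγ⟩ := h
      rw [← hγ, (orbitMap_injective H u j).extend_apply]
      rfl
    · exact Function.extend_apply' _ _ _ h
  map_add' x x' := by
    refine funext fun y => novCoeff_injective (funext fun a => ?_)
    rw [Pi.add_apply, map_add, Pi.add_apply, novCoeff_novMk, novCoeff_novMk, novCoeff_novMk]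
    by_cases h : ∃ γ, orbitMap H u j γ = (a, y)
    · obtain ⟨γ, hγ⟩ := h
      simp only [← hγ, (orbitMap_injective H u j).extend_apply]
      rfl
    · rw [Function.extend_apply' _ _ _ h, Function.extend_apply' _ _ _ h,
        Function.extend_apply' _ _ _ h]
      simp

lemma novCoeff_extendOrbit (j : G ⧸ H) (x : novikov (inducedHom H u)) (y : G ⧸ H)
    (a : G ⧸ u.ker) :
    novCoeff (extendOrbit H u j x y) a = Function.extend (orbitMap H u j) x.1 0 (a, y) := rfl

lemma extendOrbit_equivariant (j : G ⧸ H) (g : G) (x : novikov (inducedHom H u)) :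
    extendOrbit H u j (relativeNovikovRep H u g x) =
      completedRep H u g (extendOrbit H u j x) := by
  refine funext fun y => novCoeff_injective (funext fun a => ?_)
  rw [novCoeff_completedRep, novCoeff_extendOrbit, novCoeff_extendOrbit]
  by_cases h : ∃ γ, orbitMap H u j γ = ((g : G ⧸ u.ker)⁻¹ * a, g⁻¹ • y)
  · obtain ⟨γ, hγ⟩ := h
    have h2 : orbitMap H u j ((g : G ⧸ (H ⊓ u.ker)) * γ) = (a, y) := by
      rw [orbitMap_mk_mul, hγ]
      simp
    rw [← hγ, ← h2, (orbitMap_injective H u j).extend_apply,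
      (orbitMap_injective H u j).extend_apply, relativeNovikovRep_apply, inv_mul_cancel_left]
  · rw [Function.extend_apply' _ _ _ h, Function.extend_apply']
    · rfl
    · rintro ⟨γ, hγ⟩
      refine h ⟨(g⁻¹ : G) * γ, ?_⟩
      rw [orbitMap_mk_mul, hγ]
      rfl

lemma toNovikov_single_mem_range (j : G ⧸ H) [DecidableEq (G ⧸ H)] :
    (toNovikov (QuotientGroup.kerLift u)).compLeft (G ⧸ H) (Pi.single j 1) ∈
      (extendOrbit H u j).range := by
  classical
  let δ : novikov (inducedHom H u) := ⟨Pi.single 1 1, fun C =>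
    (Set.finite_singleton 1).subset fun γ hγ => by
      by_contra hne
      exact hγ.1 (by simp [show γ ≠ 1 from hne])⟩
  refine ⟨δ, funext fun y => novCoeff_injective (funext fun a => ?_)⟩
  have h1 : orbitMap H u j 1 = (1, j) := by
    refine Prod.ext (map_one _) ?_
    change QuotientGroup.map (H ⊓ u.ker) H (MonoidHom.id G) inf_le_left 1 * j = j
    rw [map_one, one_mul]
  rw [novCoeff_extendOrbit, LinearMap.compLeft_apply, Function.comp_apply, novCoeff_toNovikov]
  have hrhs : (Pi.single (M := fun _ => QuotientRing u) j 1 y).coeff a =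
      if (a, y) = (1, j) then 1 else 0 := by
    by_cases hy : y = j
    · subst hy
      rw [Pi.single_eq_same, MonoidAlgebra.one_def, MonoidAlgebra.coeff_single,
        Finsupp.single_apply]
      simp [eq_comm]
    · simp [hy]
  rw [hrhs]
  by_cases h : ∃ γ, orbitMap H u j γ = (a, y)
  · obtain ⟨γ, hγ⟩ := h
    rw [← hγ, (orbitMap_injective H u j).extend_apply, ← h1]
    simp [δ, Pi.single_apply, (orbitMap_injective H u j).eq_iff]
  · rw [Function.extend_apply' _ _ _ h, if_neg]
    · rfl
    · intro e
      exact h ⟨1, by rw [h1, e]⟩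

variable [H.FiniteIndex]

/-- Restriction to an orbit. -/
def restrictOrbit (j : G ⧸ H) : CompletedModule H u →+ novikov (inducedHom H u) where
  toFun f := ⟨fun γ => novCoeff (f (orbitMap H u j γ).2) (orbitMap H u j γ).1, fun C => by
    have : Set.Finite (⋃ y : G ⧸ H, (fun a => (a, y)) ''
        {a | novCoeff (f y) a ≠ 0 ∧ (QuotientGroup.kerLift u a).toAdd ≤ C}) :=
      Set.finite_iUnion fun y => (finite_novCoeff (f y) C).image _
    refine (this.preimage (orbitMap_injective H u j).injOn).subset ?_
    rintro γ ⟨hγ, hC⟩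
    refine Set.mem_iUnion.2 ⟨(orbitMap H u j γ).2, (orbitMap H u j γ).1, ⟨hγ, ?_⟩, rfl⟩
    rw [kerLift_orbitMap]
    exact hC⟩
  map_zero' := rfl
  map_add' f f' := rfl

lemma restrictOrbit_apply (j : G ⧸ H) (f : CompletedModule H u) (γ : G ⧸ (H ⊓ u.ker)) :
    (restrictOrbit H u j f).1 γ = novCoeff (f (orbitMap H u j γ).2) (orbitMap H u j γ).1 := rfl

lemma restrictOrbit_equivariant (j : G ⧸ H) (g : G) (f : CompletedModule H u) :
    restrictOrbit H u j (completedRep H u g f) =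
      relativeNovikovRep H u g (restrictOrbit H u j f) := by
  refine Subtype.ext (funext fun γ => ?_)
  rw [relativeNovikovRep_apply, restrictOrbit_apply, restrictOrbit_apply, novCoeff_completedRep]
  have : (g : G ⧸ (H ⊓ u.ker))⁻¹ * γ = ((g⁻¹ : G) : G ⧸ (H ⊓ u.ker)) * γ := rfl
  rw [this, orbitMap_mk_mul]
  rfl

lemma restrictOrbit_extendOrbit (j : G ⧸ H) (x : novikov (inducedHom H u)) :
    restrictOrbit H u j (extendOrbit H u j x) = x := by
  refine Subtype.ext (funext fun γ => ?_)
  rw [restrictOrbit_apply, novCoeff_extendOrbit]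
  exact (orbitMap_injective H u j).extend_apply _ _ _

/-- If the completed twisted homology vanishes, then so does the relative Novikov homology. -/
lemma relativeNovikov_le_of_completed
    (h : LinearMap.ker (diffOne (completedRep H u)) ≤
      LinearMap.range (diffTwo (completedRep H u))) :
    LinearMap.ker (diffOne (relativeNovikovRep H u)) ≤
      LinearMap.range (diffTwo (relativeNovikovRep H u)) := by
  intro z hz
  have h1 : Finsupp.mapRange.addMonoidHom (extendOrbit H u 1) z ∈
      LinearMap.ker (diffOne (completedRep H u)) := by
    rw [LinearMap.mem_ker, diffOne_mapRange (relativeNovikovRep H u) (completedRep H u) _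
      (extendOrbit_equivariant H u 1), LinearMap.mem_ker.1 hz, map_zero]
  obtain ⟨w, hw⟩ := h h1
  refine ⟨Finsupp.mapRange.addMonoidHom (restrictOrbit H u 1) w, ?_⟩
  rw [diffTwo_mapRange (completedRep H u) (relativeNovikovRep H u) _
    (restrictOrbit_equivariant H u 1), hw]
  refine Finsupp.ext fun g => ?_
  exact restrictOrbit_extendOrbit H u 1 (z g)

/-- If the relative Novikov homology vanishes, then completed cycles supported on a single orbit are
boundaries. -/
lemma mem_range_of_mem_range_extendOrbit
    (h : LinearMap.ker (diffOne (relativeNovikovRep H u)) ≤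
      LinearMap.range (diffTwo (relativeNovikovRep H u)))
    {z : G →₀ CompletedModule H u} (hz : diffOne (completedRep H u) z = 0) (j : G ⧸ H)
    (hj : ∀ g, z g ∈ (extendOrbit H u j).range) :
    z ∈ LinearMap.range (diffTwo (completedRep H u)) := by
  have h1 : Finsupp.mapRange.addMonoidHom (restrictOrbit H u j) z ∈
      LinearMap.ker (diffOne (relativeNovikovRep H u)) := by
    rw [LinearMap.mem_ker, diffOne_mapRange (completedRep H u) (relativeNovikovRep H u) _
      (restrictOrbit_equivariant H u j), hz, map_zero]
  obtain ⟨w, hw⟩ := h h1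
  refine ⟨Finsupp.mapRange.addMonoidHom (extendOrbit H u j) w, ?_⟩
  rw [diffTwo_mapRange (relativeNovikovRep H u) (completedRep H u) _
    (extendOrbit_equivariant H u j), hw]
  refine Finsupp.ext fun g => ?_
  obtain ⟨x, hx⟩ := hj g
  change extendOrbit H u j (restrictOrbit H u j (z g)) = z g
  rw [← hx, restrictOrbit_extendOrbit]

/-- If the relative Novikov homology vanishes, then the images of the standard cycles over
`ℤ[G / ker u]` are boundaries over the Novikov completion. -/
lemma chainMap_cycleMap_mem_range
    (h : LinearMap.ker (diffOne (relativeNovikovRep H u)) ≤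
      LinearMap.range (diffTwo (relativeNovikovRep H u))) (γ : G)
    (z : G →₀ (G ⧸ H → QuotientRing u)) :
    chainMap H G (toNovikov (QuotientGroup.kerLift u)) (cycleMap H u (QuotientRing u) γ z) ∈
      LinearMap.range (diffTwo (completedRep H u)) := by
  classical
  have := Fintype.ofFinite (G ⧸ H)
  induction z using Finsupp.induction_linear with
  | zero => simp
  | add a b ha hb => rw [map_add, map_add]; exact add_mem ha hb
  | single y f =>
    have hf : f = ∑ j, f j • Pi.single j (1 : QuotientRing u) := by
      funext x
      simp [Finset.sum_apply, Pi.single_apply]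
    have hsing : Finsupp.single y f =
        ∑ j, f j • Finsupp.single y (Pi.single j (1 : QuotientRing u)) := by
      conv_lhs => rw [hf]
      simp only [Finsupp.smul_single]
      exact map_sum (Finsupp.singleAddHom y) _ _
    rw [hsing, map_sum, map_sum]
    refine Submodule.sum_mem _ fun j _ => ?_
    rw [map_smul, map_smul]
    refine Submodule.smul_mem _ _ ?_
    rw [← cycleMap_chainMap, chainMap_single]
    refine mem_range_of_mem_range_extendOrbit H u h (diffOne_cycleMap γ _) j fun g => ?_
    -- The series on one orbit form a G-stable subgroup S, and `cycleMap` preserves chains with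
    -- values in S, since its scalar γ ^ n - 1 also acts through G.
    let S := (extendOrbit H u j).range
    let e := (toNovikov (QuotientGroup.kerLift u)).compLeft (G ⧸ H)
      (Pi.single j (1 : QuotientRing u))
    have he : e ∈ S := toNovikov_single_mem_range H u j
    have hS (g : G) (f : CompletedModule H u) (hf : f ∈ S) : completedRep H u g f ∈ S := by
      obtain ⟨x, rfl⟩ := hf
      exact ⟨_, extendOrbit_equivariant H u j g x⟩
    have hsingle (a : G) (f : CompletedModule H u) (hf : f ∈ S) : Finsupp.single a f g ∈ S := by
      rw [Finsupp.single_apply]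
      split_ifs
      · exact hf
      · exact zero_mem _
    change cycleMap H u (NovikovModule (QuotientGroup.kerLift u)) γ (Finsupp.single y e) g ∈ S
    rw [cycleMap_apply, Finsupp.sub_apply, Finsupp.smul_single, diffOne_single]
    refine sub_mem (hsingle _ _ ?_) (hsingle _ _ ?_)
    · rw [shiftSubOne, sub_smul, one_smul, ← twistedRep_pow_index]
      exact sub_mem (hS _ _ he) he
    · rw [normMap, LinearMap.sum_apply]
      refine sum_mem fun i _ => ?_
      rw [← map_pow]
      exact hS _ _ (sub_mem (hS _ _ he) he)

end Comparison

/-! ### Monic annihilators of the Alexander module and the main theorem -/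

section Main

lemma exists_pos {G : Type} [Group G] (u : G →* Multiplicative ℝ) (hu : u ≠ 1) :
    ∃ γ : G, 0 < (u γ).toAdd := by
  obtain ⟨g, hg⟩ : ∃ g, u g ≠ 1 := by
    by_contra! h
    exact hu (MonoidHom.ext h)
  rcases lt_trichotomy (u g).toAdd 0 with h | h | h
  · exact ⟨g⁻¹, by simpa using h⟩
  · exact absurd (Multiplicative.toAdd.injective (by simpa using h)) hg
  · exact ⟨g, h⟩

variable {G : Type} [Group G] [Group.FG G] (H : Subgroup G) [H.Normal] [H.FiniteIndex]
  (u : G →* Multiplicative ℝ)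

/-- The relative Novikov homology vanishes if and only if the twisted Alexander module is
annihilated by a monic element. -/
theorem subsingleton_abelianizedNovikovHomology_iff (hu : u ≠ 1) :
    Subsingleton (abelianizedNovikovHomology H u) ↔
      ∃ s, IsMonic (QuotientGroup.kerLift u) s ∧ ∀ m : alexanderModule H u, s • m = 0 := by
  obtain ⟨γ, hγ⟩ := exists_pos u hu
  have hv := QuotientGroup.kerLift_injective u
  have hkill (s : QuotientRing u) : (∀ m : alexanderModule H u, s • m = 0) ↔
      ∀ z, diffOne (twistedRep H u (QuotientRing u)) z = 0 →
        s • z ∈ LinearMap.range (diffTwo (twistedRep H u (QuotientRing u))) :=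
    smul_homologyOne_eq_zero_iff (twistedRep H u (QuotientRing u)) s
  simp only [hkill]
  rw [abelianizedNovikovHomology, subsingleton_homologyOne_iff]
  constructor
  · intro h
    exact exists_isMonic_smul_mem_range hγ (chainMap_cycleMap_mem_range H u h γ)
  · rintro ⟨s, hs, hz⟩
    refine relativeNovikov_le_of_completed H u fun z hz' => ?_
    exact mem_range_of_bijective
      (bijective_smul_of_isMonic ((isMonic_mul_iff hv).2 ⟨hs, isMonic_shiftSubOne H hγ⟩))
      (smul_mem_range_of_forall γ hz hz')

/-- G need not be finitely presented: the homology embeds in chains modulo boundaries, which are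
finitely generated over a Noetherian ring. -/
instance finite_alexanderModule : Module.Finite (QuotientRing u) (alexanderModule H u) := by
  have : IsNoetherianRing (QuotientRing u) := isNoetherianRing_monoidAlgebra
  rw [alexanderModule, alexanderRep_eq]
  let D := LinearMap.range (diffTwo (twistedRep H u (QuotientRing u)))
  let Z := LinearMap.ker (diffOne (twistedRep H u (QuotientRing u)))
  have : Module.Finite (QuotientRing u) ((G →₀ (G ⧸ H → QuotientRing u)) ⧸ D) :=
    ⟨fg_top_chains_quotient_boundaries _⟩
  have hinj : Function.Injective ((D.comap Z.subtype).mapQ D Z.subtype le_rfl) := by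
    rw [← LinearMap.ker_eq_bot, Submodule.mapQ, Submodule.ker_liftQ_eq_bot']
    rw [LinearMap.ker_comp, Submodule.ker_mkQ]
  have : Module.Finite (QuotientRing u) (Z ⧸ D.comap Z.subtype) :=
    Module.Finite.of_injective _ hinj
  exact Module.Finite.equiv (homologyOneEquiv (twistedRep H u (QuotientRing u)))

end Main

end TwistedAlexander

end

theorem mainTheorem5 {G : Type} [Group G] [Group.FG G]
    (u : G →* Multiplicative ℝ) (hu : u ≠ 1) (H : Subgroup G) [H.Normal] [H.FiniteIndex] :
    (∃ Δ, TwistedAlexander.IsTwistedAlexanderPolynomial H u Δ) ∧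
    ∀ Δ, TwistedAlexander.IsTwistedAlexanderPolynomial H u Δ →
      (TwistedAlexander.IsMonic (QuotientGroup.kerLift u) Δ ↔
        Subsingleton (TwistedAlexander.abelianizedNovikovHomology H u)) := by
  have hv := QuotientGroup.kerLift_injective u
  constructor
  · have := TwistedAlexander.isDomain_of_injective hv
    have := TwistedAlexander.uniqueFactorizationMonoid_of_injective hv
    have : IsNoetherianRing (TwistedAlexander.QuotientRing u) :=
      TwistedAlexander.isNoetherianRing_monoidAlgebra
    obtain ⟨p, q, A, π, h⟩ := TwistedAlexander.exists_isMatrixPresentation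
      (R := TwistedAlexander.QuotientRing u) (M := TwistedAlexander.alexanderModule H u)
    obtain ⟨d, hd⟩ := TwistedAlexander.exists_isGcdOfIdeal (TwistedAlexander.minorIdeal A)
    exact ⟨d, p, q, A, π, h, hd⟩
  · rintro Δ ⟨p, q, A, π, h, hd⟩
    rw [hd.isMonic_iff hv, TwistedAlexander.subsingleton_abelianizedNovikovHomology_iff H u hu]
    constructor
    · rintro ⟨s, hs, hm⟩
      exact ⟨s, hm, h.smul_eq_zero hs⟩
    · rintro ⟨s, hm, hs⟩
      exact ⟨s ^ p, h.pow_mem_minorIdeal hs,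
        pow_mem (S := TwistedAlexander.monicSubmonoid hv) hm p⟩
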